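/- Let $d\ge 1$ be an integer and let $\mathcal S(\mathcal H)$ be the set of density operators on $\mathcal H=\mathbb C^d$. Let $\hat\rho:\mathbb R^{d^2-1}\to\{A=A^\dagger,\ \mathrm{Tr}A=1\}$ be an affine bijection, and $S=\{\boldsymbol s:\hat\rho(\boldsymbol s)\in\mathcal S(\mathcal H)\}$, with interior $S^{o}$. Let $\{\hat\Pi_x\}_{x\in\Omega}$ be a POVM on $\mathcal H$ with finite outcome set $\Omega$, put $p_{\boldsymbol s}(x)=\mathrm{Tr}[\hat\rho(\boldsymbol s)\hat\Pi_x]$, and let $P^{(N)}_{\boldsymbol s}$ be the law of $N$ independent outcomes with distribution $p_{\boldsymbol s}$. An estimator is a sequence of maps $\boldsymbol s^{\mathrm{est}}_N:\Omega^N\to S$. A maximum likelihood estimator is one for which $\boldsymbol s^{\mathrm{ml}}_N(x_1,\dots,x_N)$ always maximizes $\prod_i p_{\boldsymbol t}(x_i)$ over $\boldsymbol t\in S$. Let $\Delta:S\times S\to\mathbb R$ be a pseudo-distance: $\Delta\ge 0$, and $\Delta(\boldsymbol a,\boldsymbol b)=0$ if and only if $\boldsymbol a=\boldsymbol b$ (neither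 symmetry nor the triangle inequality is required). Assume that $\Delta(\cdot,\boldsymbol b)$ is continuous on $S$ for every $\boldsymbol b\in S$. An estimator is consistent if $P^{(N)}_{\boldsymbol t}(\Delta(\boldsymbol s^{\mathrm{est}}_N,\boldsymbol t)>\eta)\to 0$ as $N\to\infty$ for all $\boldsymbol t\in S$ and $\eta>0$. Let $\boldsymbol s\in S^{o}$ be such that $\Delta(\cdot,\boldsymbol s)$ is $C^2$ at $\boldsymbol s$ and the same-point Hesse matrix $H_{\boldsymbol s}=[\partial_{s'^\alpha}\partial_{s'^\beta}\Delta(\boldsymbol s',\boldsymbol s)|_{\boldsymbol s'=\boldsymbol s}]$ is non-zero. Let $F_{\boldsymbol s}=\sum_x p_{\boldsymbol s}(x)\,\nabla\log p_{\boldsymbol s}(x)\,\nabla\log p_{\boldsymbol s}(x)^T$ be the Fisher matrix, and let $\sigma_1$ denote the largest eigenvalue. Then $H_{\boldsymbol s}$ is positive semidefinite, and the following hold, where logarithms take the value $-\infty$ at $0$. (1) For every consistent estimator $\boldsymbol s^{\mathrm{est}}$ (in whose presence $F_{\boldsymbol s}$ is invertible and $\sigma_1(\sqrt{H_{\boldsymbol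 s}}F_{\boldsymbol s}^{-1}\sqrt{H_{\boldsymbol s}})>0$), $$\liminf_{\epsilon\to0^+}\ \liminf_{N\to\infty}\frac1{\epsilon^2N}\log P^{(N)}_{\boldsymbol s}\bigl(\Delta(\boldsymbol s^{\mathrm{est}}_N,\boldsymbol s)>\epsilon^2\bigr)\ \ge\ -\frac1{\sigma_1\bigl(\sqrt{H_{\boldsymbol s}}F_{\boldsymbol s}^{-1}\sqrt{H_{\boldsymbol s}}\bigr)} .$$ (2) Suppose the POVM is informationally complete, i.e. density operators with the same outcome probabilities are equal. Then a maximum likelihood estimator exists, and every maximum likelihood estimator $\boldsymbol s^{\mathrm{ml}}$ is consistent and satisfies $$\lim_{\epsilon\to0^+}\ \lim_{N\to\infty}\frac1{\epsilon^2N}\log P^{(N)}_{\boldsymbol s}\bigl(\Delta(\boldsymbol s^{\mathrm{ml}}_N,\boldsymbol s)>\epsilon^2\bigr)\ =\ -\frac1{\sigma_1\bigl(\sqrt{H_{\boldsymbol s}}F_{\boldsymbol s}^{-1}\sqrt{H_{\boldsymbol s}}\bigr)},$$ the inner limit existing for all sufficiently small $\epsilon>0$. -/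

import Mathlib

open Filter Topology
open scoped ComplexOrder

namespace QTomography

noncomputable section

/-- The real parameter space `ℝ^(d²-1)`, with its Euclidean structure. -/
abbrev Param (d : ℕ) : Type := EuclideanSpace ℝ (Fin (d ^ 2 - 1))

/-- Operators on the `d`-dimensional Hilbert space `ℂ^d`. -/
abbrev Op (d : ℕ) : Type := Matrix (Fin d) (Fin d) ℂ

/-- The set of density operators on `ℂ^d`. -/
def densityOps (d : ℕ) : Set (Op d) :=
  {A | A.PosSemidef ∧ A.trace = 1}

/-- A linear (affine) one-to-one parametrization by `d² - 1` real parameters of the Hermitian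
operators of trace one, of which the density operators are the positive semidefinite ones. -/
structure IsParametrization {d : ℕ} (ρ : Param d →ᵃ[ℝ] Op d) : Prop where
  injective : Function.Injective ρ
  range_eq : Set.range ρ = {A : Op d | A.IsHermitian ∧ A.trace = 1}

/-- The parameter set `S` of all `s` for which `ρ s` is a density operator. -/
def stateSpace {d : ℕ} (ρ : Param d →ᵃ[ℝ] Op d) : Set (Param d) :=
  {s | ρ s ∈ densityOps d}

/-- A positive operator-valued measure with finite outcome set `Ω`. -/
structure IsPOVM {d : ℕ} {Ω : Type*} [Fintype Ω] (T : Ω → Op d) : Prop where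
  posSemidef : ∀ x, (T x).PosSemidef
  sum_eq_one : ∑ x, T x = 1

/-- Informational completeness: the outcome probabilities of a density operator determine it. -/
def InformationallyComplete {d : ℕ} {Ω : Type*} (T : Ω → Op d) : Prop :=
  ∀ A ∈ densityOps d, ∀ B ∈ densityOps d,
    (∀ x, (A * T x).trace = (B * T x).trace) → A = B

/-- The outcome probability `p_s(x) = Tr[ρ(s) T_x]` (the trace is real, both factors being
Hermitian). -/
def prob {d : ℕ} {Ω : Type*} (ρ : Param d →ᵃ[ℝ] Op d) (T : Ω → Op d) (s : Param d) (x : Ω) : ℝ :=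
  (ρ s * T x).trace.re

/-- The probability of the data `x = (x_1, …, x_N)` in `N` independent trials, that is, the
likelihood of `s` given the data `x`. -/
def likelihood {d : ℕ} {Ω : Type*} (ρ : Param d →ᵃ[ℝ] Op d) (T : Ω → Op d) {N : ℕ}
    (s : Param d) (x : Fin N → Ω) : ℝ :=
  ∏ i, prob ρ T s (x i)

/-- An estimator: for each number `N` of trials, a map from data to the parameter set `S`. -/
def IsEstimator {d : ℕ} {Ω : Type*} (ρ : Param d →ᵃ[ℝ] Op d)
    (φ : (N : ℕ) → (Fin N → Ω) → Param d) : Prop :=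
  ∀ N x, φ N x ∈ stateSpace ρ

/-- A maximum likelihood estimator: each estimate maximizes the likelihood of the data over `S`. -/
def IsMLE {d : ℕ} {Ω : Type*} (ρ : Param d →ᵃ[ℝ] Op d) (T : Ω → Op d)
    (φ : (N : ℕ) → (Fin N → Ω) → Param d) : Prop :=
  IsEstimator ρ φ ∧
    ∀ N (x : Fin N → Ω), IsMaxOn (fun t => likelihood ρ T t x) (stateSpace ρ) (φ N x)

open Classical in
/-- The error probability `P_s^{(N)}(Δ(φ_N, s) > η)` at threshold `η`. -/
def errorProb {d : ℕ} {Ω : Type*} [Fintype Ω] (ρ : Param d →ᵃ[ℝ] Op d) (T : Ω → Op d)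
    (Δ : Param d → Param d → ℝ) (φ : (N : ℕ) → (Fin N → Ω) → Param d)
    (s : Param d) (η : ℝ) (N : ℕ) : ℝ :=
  ∑ x : Fin N → Ω with η < Δ (φ N x) s, likelihood ρ T s x

/-- (Weak) consistency in the loss function `Δ`, at every parameter of `S`. -/
def IsConsistent {d : ℕ} {Ω : Type*} [Fintype Ω] (ρ : Param d →ᵃ[ℝ] Op d) (T : Ω → Op d)
    (Δ : Param d → Param d → ℝ) (φ : (N : ℕ) → (Fin N → Ω) → Param d) : Prop :=
  ∀ s ∈ stateSpace ρ, ∀ η : ℝ, 0 < η →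
    Tendsto (fun N => errorProb ρ T Δ φ s η N) atTop (𝓝 0)

/-- `(1 / (ε² N)) log P_s^{(N)}(Δ(φ_N, s) > ε²)`, as an extended real number (`log 0 = -∞`). -/
def logErrorRate {d : ℕ} {Ω : Type*} [Fintype Ω] (ρ : Param d →ᵃ[ℝ] Op d) (T : Ω → Op d)
    (Δ : Param d → Param d → ℝ) (φ : (N : ℕ) → (Fin N → Ω) → Param d)
    (s : Param d) (ε : ℝ) (N : ℕ) : EReal :=
  ((1 / (ε ^ 2 * (N : ℝ)) : ℝ) : EReal) *
    ENNReal.log (ENNReal.ofReal (errorProb ρ T Δ φ s (ε ^ 2) N))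

/-- A pseudo-distance on `S`: a nonnegative loss function which vanishes exactly on the diagonal.
Neither symmetry nor the triangle inequality is required. -/
structure IsPseudoDistanceOn {α : Type*} (Δ : α → α → ℝ) (S : Set α) : Prop where
  nonneg : ∀ a ∈ S, ∀ b ∈ S, 0 ≤ Δ a b
  self_eq_zero : ∀ a ∈ S, Δ a a = 0
  eq_of_eq_zero : ∀ a ∈ S, ∀ b ∈ S, Δ a b = 0 → a = b

/-- The same-point Hesse matrix `[∂_α ∂_β Δ(s', s)]` at `s' = s`, the derivatives being taken in
the first variable. -/
def hesse {d : ℕ} (Δ : Param d → Param d → ℝ) (s : Param d) :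
    Matrix (Fin (d ^ 2 - 1)) (Fin (d ^ 2 - 1)) ℝ :=
  Matrix.of fun α β =>
    fderiv ℝ (fun t => fderiv ℝ (fun u => Δ u s) t (EuclideanSpace.single β 1)) s
      (EuclideanSpace.single α 1)

/-- The Fisher matrix `∑_x p_s(x) (∇ log p_s(x)) (∇ log p_s(x))ᵀ`. -/
def fisher {d : ℕ} {Ω : Type*} [Fintype Ω] (ρ : Param d →ᵃ[ℝ] Op d) (T : Ω → Op d)
    (s : Param d) : Matrix (Fin (d ^ 2 - 1)) (Fin (d ^ 2 - 1)) ℝ :=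
  Matrix.of fun α β => ∑ x, prob ρ T s x *
    fderiv ℝ (fun t => Real.log (prob ρ T t x)) s (EuclideanSpace.single α 1) *
    fderiv ℝ (fun t => Real.log (prob ρ T t x)) s (EuclideanSpace.single β 1)

/-- The positive semidefinite square root of a positive semidefinite real matrix. -/
def matrixSqrt {n : Type*} [Fintype n] [DecidableEq n] (A : Matrix n n ℝ) : Matrix n n ℝ :=
  cfc Real.sqrt A

/-- The largest eigenvalue of a real symmetric matrix. -/
def maxEigenvalue {n : Type*} [Fintype n] [DecidableEq n] (A : Matrix n n ℝ) : ℝ :=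
  sSup {c : ℝ | Module.End.HasEigenvalue (Matrix.toLin' A) c}

/-- `σ₁(√H_s F_s⁻¹ √H_s)`. -/
def sigmaOne {d : ℕ} {Ω : Type*} [Fintype Ω] (ρ : Param d →ᵃ[ℝ] Op d) (T : Ω → Op d)
    (Δ : Param d → Param d → ℝ) (s : Param d) : ℝ :=
  maxEigenvalue (matrixSqrt (hesse Δ s) * (fisher ρ T s)⁻¹ * matrixSqrt (hesse Δ s))

end

end QTomography

namespace QTomography

noncomputable section

/-! The theorem is a large deviation estimate for empirical distributions, localized near `s`. By
Sanov's upper bound (`sum_iid_le_of_le_relEntropy`), types at relative entropy at least c from p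
have probability at most a polynomial times exp(-Nc). Conversely (`eventually_exp_le_sum_iid`), an
event that is typical under q has probability at least exp(-N(D(q‖p)+δ)) under p. For v = t - s
small, D(p_t‖p_s) is close to vᵀFv/2, and Δ(t,s) is close to vᵀHv/2 because Δ(·,s) has a minimum at
s. The cheapest error of size ε² thus minimizes vᵀFv/2 subject to vᵀHv/2 = ε². The value is ε²/σ₁,
since σ₁ is the largest generalized eigenvalue of H relative to F.

For a consistent estimator, choose t just beyond the threshold in the optimal direction. Consistency
at t makes the error relative to s typical under p_t, and a change of measure gives the bound
(`le_liminf_logErrorRate_of_lt`). Consistency also forces distinct states to have distinct outcome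
laws, which makes F positive definite.

For maximum likelihood, the likelihood depends on the data only through its type Q, and convexity of
the state space gives a first order condition for maximizers. Two such conditions for nearby weights
force nearby maximizers (`exists_forall_isMaxOn_mem`). This yields consistency, and it identifies
the inner limit through the infimum of D(Q‖p_s) over types whose maximizer is in error
(`tendsto_logErrorRate`). One half of the outer limit is the general bound. For the other half, the
first order condition shows that Q is at least as far from p_s as p_t is, in the chi-squared sense
(`sum_sq_sub_div_le_of_sum_mul_div_le_one`), and then H ≤ σ₁F applies.

Interiority of s removes support problems: an outcome of probability zero at s is impossible at
every parameter. Types missing a possible outcome cost a fixed positive exponent, so they are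
irrelevant for small ε. -/

/-- The probability of the data `x` under independent sampling from the weights `q`. -/
def iid {Ω : Type*} (q : Ω → ℝ) {N : ℕ} (x : Fin N → Ω) : ℝ := ∏ i, q (x i)

/-- The relative entropy `∑ q log (q / p)`. -/
def relEntropy {Ω : Type*} [Fintype Ω] (q p : Ω → ℝ) : ℝ := ∑ ω, q ω * Real.log (q ω / p ω)

open Classical in
/-- The empirical distribution of the data `x`. -/
def emp {Ω : Type*} {N : ℕ} (x : Fin N → Ω) (ω : Ω) : ℝ :=
  ((Finset.univ.filter fun i => x i = ω).card : ℝ) / N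

/-! ### Method of types: Sanov's bounds -/

section

variable {Ω : Type*} {N : ℕ} {p q : Ω → ℝ}

lemma iid_nonneg (hq : ∀ ω, 0 ≤ q ω) (x : Fin N → Ω) : 0 ≤ iid q x :=
  Finset.prod_nonneg fun _ _ => hq _

lemma iid_pos_iff (hq : ∀ ω, 0 ≤ q ω) (x : Fin N → Ω) : 0 < iid q x ↔ ∀ i, 0 < q (x i) := by
  constructor
  · intro h i
    refine (hq _).lt_of_ne fun h0 => h.ne' ?_
    exact Finset.prod_eq_zero (Finset.mem_univ i) h0.symm
  · exact fun h => Finset.prod_pos fun i _ => h i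

lemma emp_nonneg (x : Fin N → Ω) (ω : Ω) : 0 ≤ emp x ω := by
  unfold emp; positivity

lemma emp_pos (hN : 0 < N) (x : Fin N → Ω) (i : Fin N) : 0 < emp x (x i) := by
  classical
  unfold emp
  have : 0 < (Finset.univ.filter fun j => x j = x i).card :=
    Finset.card_pos.2 ⟨i, by simp⟩
  positivity

lemma exists_of_emp_ne_zero {x : Fin N → Ω} {ω : Ω} (h : emp x ω ≠ 0) : ∃ i, x i = ω := by
  classical
  by_contra! hc
  apply h
  simp [emp, hc]

lemma emp_eq_zero_of_pos {x : Fin N → Ω} (hx : ∀ i, 0 < p (x i)) {ω : Ω} (h : p ω = 0) :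
    emp x ω = 0 := by
  by_contra h0
  obtain ⟨i, rfl⟩ := exists_of_emp_ne_zero h0
  exact (hx i).ne' h

variable [Fintype Ω]

lemma sum_iid (hq : q ∈ stdSimplex ℝ Ω) : ∑ x : Fin N → Ω, iid q x = 1 := by
  classical
  have := Finset.prod_univ_sum (fun _ : Fin N => (Finset.univ : Finset Ω)) (fun _ ω => q ω)
  simp only [hq.2, Finset.prod_const_one, Fintype.piFinset_univ] at this
  exact this.symm

lemma sum_comp_eq_sum_emp (hN : 0 < N) (x : Fin N → Ω) (g : Ω → ℝ) :
    ∑ i, g (x i) = N * ∑ ω, emp x ω * g ω := by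
  classical
  have hN' : (N : ℝ) ≠ 0 := by positivity
  rw [Finset.mul_sum, ← Finset.sum_fiberwise (Finset.univ) x]
  refine Finset.sum_congr rfl fun ω _ => ?_
  rw [Finset.sum_congr rfl (g := fun _ => g ω) (by simp +contextual)]
  simp only [Finset.sum_const, nsmul_eq_mul, emp]
  field_simp

lemma emp_mem_stdSimplex (hN : 0 < N) (x : Fin N → Ω) : emp x ∈ stdSimplex ℝ Ω := by
  refine ⟨emp_nonneg x, ?_⟩
  have h := sum_comp_eq_sum_emp hN x (fun _ => 1)
  have hN' : (N : ℝ) ≠ 0 := by positivity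
  simp only [Finset.sum_const, Finset.card_univ, Fintype.card_fin, nsmul_eq_mul, mul_one] at h
  exact (mul_right_cancel₀ hN' (by linarith))

lemma iid_eq_exp (hN : 0 < N) {x : Fin N → Ω} (h : ∀ i, 0 < q (x i)) :
    iid q x = Real.exp (N * ∑ ω, emp x ω * Real.log (q ω)) := by
  rw [← sum_comp_eq_sum_emp hN x (fun ω => Real.log (q ω)), Real.exp_sum]
  exact Finset.prod_congr rfl fun i _ => (Real.exp_log (h i)).symm

/-- Change of measure. -/
lemma iid_eq_iid_mul_exp (hN : 0 < N) {x : Fin N → Ω} (hq : ∀ i, 0 < q (x i))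
    (hp : ∀ i, 0 < p (x i)) :
    iid p x = iid q x * Real.exp (-(N * ∑ ω, emp x ω * Real.log (q ω / p ω))) := by
  rw [iid_eq_exp hN hq, iid_eq_exp hN hp, ← Real.exp_add]
  congr 1
  rw [← sub_eq_add_neg, ← mul_sub, ← Finset.sum_sub_distrib]
  congr 1
  refine Finset.sum_congr rfl fun ω _ => ?_
  by_cases h0 : emp x ω = 0
  · simp [h0]
  · obtain ⟨i, rfl⟩ := exists_of_emp_ne_zero h0
    rw [Real.log_div (hq i).ne' (hp i).ne']
    ring

/-- A type is a vector of counts between 0 and N, so there are at most (N+1)^|Ω| types. The data of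
one type are all weighted by the same product distribution, whose total mass is one. -/
lemma sum_iid_emp_le (hN : 0 < N) :
    ∑ x : Fin N → Ω, iid (emp x) x ≤ ((N : ℝ) + 1) ^ Fintype.card Ω := by
  classical
  let c : (Fin N → Ω) → (Ω → Fin (N + 1)) := fun x ω =>
    ⟨(Finset.univ.filter fun i => x i = ω).card,
      Nat.lt_succ_of_le ((Finset.card_le_univ _).trans (by simp))⟩
  have hc : ∀ x ω, emp x ω = ((c x ω : ℕ) : ℝ) / N := fun x ω => by
    simp only [emp, c]
  rw [← Finset.sum_fiberwise Finset.univ c]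
  have hb : ∀ k ∈ (Finset.univ : Finset (Ω → Fin (N + 1))),
      ∑ x with c x = k, iid (emp x) x ≤ 1 := by
    intro k _
    rcases (Finset.univ.filter fun x => c x = k).eq_empty_or_nonempty with h | ⟨y, hy⟩
    · simp [h]
    · have hk : ∀ x ∈ (Finset.univ.filter fun x => c x = k), iid (emp x) x = iid (emp y) x := by
        intro x hx
        have : emp x = emp y := by
          funext ω
          rw [hc, hc, (Finset.mem_filter.1 hx).2, (Finset.mem_filter.1 hy).2]
        rw [this]
      rw [Finset.sum_congr rfl hk, ← sum_iid (emp_mem_stdSimplex hN y)]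
      exact Finset.sum_le_sum_of_subset_of_nonneg (Finset.subset_univ _)
        fun x _ _ => iid_nonneg (emp_nonneg y) x
  refine (Finset.sum_le_sum hb).trans_eq ?_
  simp

/-- Sanov's upper bound, by the method of types. -/
lemma sum_iid_le_of_le_relEntropy (hp : p ∈ stdSimplex ℝ Ω) (hN : 0 < N)
    (E : Finset (Fin N → Ω)) {c : ℝ}
    (hE : ∀ x ∈ E, (∀ i, 0 < p (x i)) → c ≤ relEntropy (emp x) p) :
    ∑ x ∈ E, iid p x ≤ ((N : ℝ) + 1) ^ Fintype.card Ω * Real.exp (-(N * c)) := by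
  calc ∑ x ∈ E, iid p x ≤ ∑ x ∈ E, iid (emp x) x * Real.exp (-(N * c)) := by
        refine Finset.sum_le_sum fun x hx => ?_
        by_cases hpos : ∀ i, 0 < p (x i)
        · rw [iid_eq_iid_mul_exp hN (fun i => emp_pos hN x i) hpos]
          refine mul_le_mul_of_nonneg_left ?_ (iid_nonneg (emp_nonneg x) x)
          have := hE x hx hpos
          unfold relEntropy at this
          gcongr
        · have h0 : iid p x ≤ 0 := not_lt.1 fun h => hpos ((iid_pos_iff hp.1 x).1 h)
          exact h0.trans (mul_nonneg (iid_nonneg (emp_nonneg x) x) (Real.exp_pos _).le)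
    _ = (∑ x ∈ E, iid (emp x) x) * Real.exp (-(N * c)) := by rw [Finset.sum_mul]
    _ ≤ _ := by
        gcongr
        refine le_trans ?_ (sum_iid_emp_le hN)
        exact Finset.sum_le_sum_of_subset_of_nonneg (Finset.subset_univ _)
          fun x _ _ => iid_nonneg (emp_nonneg x) x

/-- This is log x ≤ x - 1 at x = √(b/a). The compensating terms -a + b make every summand of the
relative entropy nonnegative, so single coordinates can be isolated. -/
lemma sq_sqrt_sub_sqrt_le {a b : ℝ} (ha : 0 ≤ a) (hb : 0 ≤ b) (hab : b = 0 → a = 0) :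
    (√a - √b) ^ 2 ≤ a * Real.log (a / b) - a + b := by
  rcases ha.eq_or_lt with rfl | ha
  · simp [Real.sq_sqrt hb]
  have hb : 0 < b := hb.lt_of_ne fun h => ha.ne' (hab h.symm)
  have hsa := Real.sqrt_pos.2 ha
  have hsb := Real.sqrt_pos.2 hb
  have h1 : Real.log (√b / √a) ≤ √b / √a - 1 := Real.log_le_sub_one_of_pos (by positivity)
  have h2 : Real.log (a / b) = -(2 * Real.log (√b / √a)) := by
    rw [← Real.sqrt_div hb.le, Real.log_sqrt (by positivity), ← inv_div, Real.log_inv]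
    ring
  have h3 : a * (√b / √a) = √a * √b := by
    have := Real.mul_self_sqrt ha.le
    field_simp
    nlinarith
  rw [h2]
  nlinarith [mul_le_mul_of_nonneg_left h1 ha.le, Real.sq_sqrt ha.le, Real.sq_sqrt hb.le]

lemma relEntropy_eq (hq : q ∈ stdSimplex ℝ Ω) (hp : p ∈ stdSimplex ℝ Ω) :
    relEntropy q p = ∑ ω, (q ω * Real.log (q ω / p ω) - q ω + p ω) := by
  rw [Finset.sum_add_distrib, Finset.sum_sub_distrib, hq.2, hp.2, relEntropy]
  ring

lemma le_one_of_mem_stdSimplex (hq : q ∈ stdSimplex ℝ Ω) (ω : Ω) : q ω ≤ 1 := by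
  rw [← hq.2]
  exact Finset.single_le_sum (fun i _ => hq.1 i) (Finset.mem_univ ω)

/-- A weak Pinsker inequality through the Hellinger distance: q - p = (√q - √p)(√q + √p), and the
second factor is at most 2. -/
lemma sq_sub_le_relEntropy (hq : q ∈ stdSimplex ℝ Ω) (hp : p ∈ stdSimplex ℝ Ω)
    (hac : ∀ ω, p ω = 0 → q ω = 0) (ω : Ω) :
    (q ω - p ω) ^ 2 / 4 ≤ relEntropy q p := by
  have key : ∀ ω, (√(q ω) - √(p ω)) ^ 2 ≤ q ω * Real.log (q ω / p ω) - q ω + p ω :=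
    fun ω => sq_sqrt_sub_sqrt_le (hq.1 ω) (hp.1 ω) (hac ω)
  have h1 : (q ω - p ω) ^ 2 / 4 ≤ (√(q ω) - √(p ω)) ^ 2 := by
    have e : q ω - p ω = (√(q ω) - √(p ω)) * (√(q ω) + √(p ω)) := by
      nlinarith [Real.sq_sqrt (hq.1 ω), Real.sq_sqrt (hp.1 ω)]
    have a1 : √(q ω) ≤ 1 := Real.sqrt_le_one.2 (le_one_of_mem_stdSimplex hq ω)
    have a2 : √(p ω) ≤ 1 := Real.sqrt_le_one.2 (le_one_of_mem_stdSimplex hp ω)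
    have a3 : (√(q ω) + √(p ω)) ^ 2 ≤ 4 := by
      nlinarith [Real.sqrt_nonneg (q ω), Real.sqrt_nonneg (p ω)]
    rw [e, mul_pow]
    nlinarith [sq_nonneg (√(q ω) - √(p ω))]
  rw [relEntropy_eq hq hp]
  refine h1.trans ((key ω).trans ?_)
  exact Finset.single_le_sum
    (f := fun ω => q ω * Real.log (q ω / p ω) - q ω + p ω)
    (fun i _ => (sq_nonneg _).trans (key i)) (Finset.mem_univ ω)

lemma relEntropy_nonneg (hq : q ∈ stdSimplex ℝ Ω) (hp : p ∈ stdSimplex ℝ Ω)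
    (hac : ∀ ω, p ω = 0 → q ω = 0) : 0 ≤ relEntropy q p := by
  rw [relEntropy_eq hq hp]
  exact Finset.sum_nonneg fun i _ =>
    (sq_nonneg _).trans (sq_sqrt_sub_sqrt_le (hq.1 i) (hp.1 i) (hac i))

lemma tendsto_types_bound (k : ℕ) {c : ℝ} (hc : 0 < c) :
    Tendsto (fun N : ℕ => ((N : ℝ) + 1) ^ k * Real.exp (-(N * c))) atTop (𝓝 0) := by
  have h1 : Tendsto (fun N : ℕ => (N : ℝ) + 1) atTop atTop :=
    tendsto_atTop_add_const_right _ _ tendsto_natCast_atTop_atTop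
  have h2 := ((Real.tendsto_pow_mul_exp_neg_atTop_nhds_zero k).comp
    (h1.const_mul_atTop hc)).const_mul (Real.exp c * (c ^ k)⁻¹)
  rw [mul_zero] at h2
  refine h2.congr fun N => ?_
  simp only [Function.comp]
  rw [mul_pow]
  have : Real.exp (-(N * c)) = Real.exp c * Real.exp (-(c * (N + 1))) := by
    rw [← Real.exp_add]; congr 1; ring
  rw [this]
  field_simp

open Classical in
/-- The weak law of large numbers for empirical distributions. -/
lemma tendsto_sum_iid_not_near (hp : p ∈ stdSimplex ℝ Ω) {κ : ℝ} (hκ : 0 < κ) :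
    Tendsto (fun N => ∑ x : Fin N → Ω with ¬ ∀ ω, |emp x ω - p ω| < κ, iid p x)
      atTop (𝓝 0) := by
  refine squeeze_zero' (Eventually.of_forall fun N => Finset.sum_nonneg fun x _ =>
    iid_nonneg hp.1 x) ?_ (tendsto_types_bound (Fintype.card Ω) (c := κ ^ 2 / 4) (by positivity))
  filter_upwards [eventually_gt_atTop 0] with N hN
  refine sum_iid_le_of_le_relEntropy hp hN _ fun x hx hpos => ?_
  simp only [Finset.mem_filter, Finset.mem_univ, true_and, not_forall, not_lt] at hx
  obtain ⟨ω, hω⟩ := hx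
  refine le_trans ?_ (sq_sub_le_relEntropy (emp_mem_stdSimplex hN x) hp
    (fun ω h => emp_eq_zero_of_pos hpos h) ω)
  rw [← sq_abs (emp x ω - p ω)]
  gcongr

/-- If `E` has probability tending to one under `q`, then its probability under `p` decays at most
with the exponent `relEntropy q p`. -/
lemma eventually_exp_le_sum_iid (hq : q ∈ stdSimplex ℝ Ω) (hp : p ∈ stdSimplex ℝ Ω)
    (hac : ∀ ω, p ω = 0 → q ω = 0) (E : (N : ℕ) → Finset (Fin N → Ω))
    (hE : Tendsto (fun N => ∑ x ∈ E N, iid q x) atTop (𝓝 1)) {δ : ℝ} (hδ : 0 < δ) :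
    ∀ᶠ N : ℕ in atTop,
      Real.exp (-(N * (relEntropy q p + δ))) ≤ ∑ x ∈ E N, iid p x := by
  classical
  set g : Ω → ℝ := fun ω => Real.log (q ω / p ω)
  -- For types within κ of q, the mean log-likelihood ratio exceeds the relative entropy by at most
  -- δ/2. The other δ/2 pays for the factor 1/2 by which the typical set is bounded below.
  obtain ⟨κ, hκ, hκδ⟩ : ∃ κ : ℝ, 0 < κ ∧ κ * ∑ ω, |g ω| ≤ δ / 2 := by
    refine ⟨δ / 2 / (∑ ω, |g ω| + 1), by positivity, ?_⟩
    rw [div_mul_eq_mul_div, div_le_iff₀ (by positivity)]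
    nlinarith [Finset.sum_nonneg fun ω (_ : ω ∈ Finset.univ) => abs_nonneg (g ω)]
  have h1 := hE.sub (tendsto_sum_iid_not_near hq hκ)
  rw [sub_zero] at h1
  have h2 : Tendsto (fun N : ℕ => Real.exp (-(N * (δ / 2)))) atTop (𝓝 0) := by
    simpa using tendsto_types_bound 0 (c := δ / 2) (by positivity)
  filter_upwards [h1.eventually (lt_mem_nhds (show (1 / 2 : ℝ) < 1 by norm_num)),
    h2.eventually (gt_mem_nhds (show (0 : ℝ) < 1 / 2 by norm_num)), eventually_gt_atTop 0]
    with N hN1 hN2 hN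
  set G := (E N).filter fun x => (∀ ω, |emp x ω - q ω| < κ) ∧ ∀ i, 0 < q (x i)
  have hG : 1 / 2 ≤ ∑ x ∈ G, iid q x := by
    have : ∑ x ∈ E N, iid q x ≤ ∑ x ∈ G, iid q x +
        ∑ x : Fin N → Ω with ¬ ∀ ω, |emp x ω - q ω| < κ, iid q x := by
      rw [← Finset.sum_filter_add_sum_filter_not (E N) fun x => ∀ ω, |emp x ω - q ω| < κ]
      refine add_le_add (le_of_eq ?_) ?_
      · rw [← Finset.sum_filter_add_sum_filter_not ((E N).filter fun x =>
          ∀ ω, |emp x ω - q ω| < κ) fun x => ∀ i, 0 < q (x i), Finset.filter_filter]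
        refine add_eq_left.2 (Finset.sum_eq_zero fun x hx => ?_)
        have := (Finset.mem_filter.1 hx).2
        rw [← iid_pos_iff hq.1] at this
        exact le_antisymm (not_lt.1 this) (iid_nonneg hq.1 x)
      · exact Finset.sum_le_sum_of_subset_of_nonneg
          (Finset.filter_subset_filter _ (Finset.subset_univ _)) fun x _ _ => iid_nonneg hq.1 x
    linarith
  calc Real.exp (-(N * (relEntropy q p + δ)))
      = Real.exp (-(N * (δ / 2))) * Real.exp (-(N * (relEntropy q p + δ / 2))) := by
        rw [← Real.exp_add]; congr 1; ring
    _ ≤ (∑ x ∈ G, iid q x) * Real.exp (-(N * (relEntropy q p + δ / 2))) := by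
        gcongr; linarith
    _ = ∑ x ∈ G, iid q x * Real.exp (-(N * (relEntropy q p + δ / 2))) := by rw [Finset.sum_mul]
    _ ≤ ∑ x ∈ G, iid p x := by
        refine Finset.sum_le_sum fun x hx => ?_
        obtain ⟨-, hnear, hpos⟩ := Finset.mem_filter.1 hx
        have hppos : ∀ i, 0 < p (x i) := fun i =>
          (hp.1 _).lt_of_ne fun h => (hpos i).ne' (hac _ h.symm)
        rw [iid_eq_iid_mul_exp hN hpos hppos]
        refine mul_le_mul_of_nonneg_left ?_ (iid_nonneg hq.1 x)
        have : ∑ ω, emp x ω * g ω - relEntropy q p ≤ δ / 2 := by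
          rw [relEntropy, ← Finset.sum_sub_distrib]
          refine le_trans ?_ hκδ
          rw [Finset.mul_sum]
          refine Finset.sum_le_sum fun ω _ => ?_
          rw [← sub_mul]
          refine (le_abs_self _).trans ?_
          rw [abs_mul]
          exact mul_le_mul_of_nonneg_right (hnear ω).le (abs_nonneg _)
        gcongr
        linarith
    _ ≤ ∑ x ∈ E N, iid p x :=
        Finset.sum_le_sum_of_subset_of_nonneg (Finset.filter_subset _ _)
          fun x _ _ => iid_nonneg hp.1 x

end

/-- The third order remainder that makes relative entropy agree with half the chi-squared divergence
near the diagonal. -/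
lemma abs_mul_log_sub_sub_sq_le {h : ℝ} (hh : |h| ≤ 1 / 2) :
    |(1 + h) * Real.log (1 + h) - h - h ^ 2 / 2| ≤ 4 * |h| ^ 3 := by
  have h1 := Real.abs_log_sub_add_sum_range_le (x := -h) (by rw [abs_neg]; linarith) 2
  rw [Finset.sum_range_succ, Finset.sum_range_one, abs_neg, sub_neg_eq_add] at h1
  norm_num at h1
  set e := -h + h ^ 2 / 2 + Real.log (1 + h) with he
  have h2 : |e| ≤ 2 * |h| ^ 3 := by
    refine h1.trans ?_
    rw [div_le_iff₀ (by linarith)]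
    nlinarith [pow_nonneg (abs_nonneg h) 3]
  have e1 : (1 + h) * Real.log (1 + h) - h - h ^ 2 / 2 = -h ^ 3 / 2 + (1 + h) * e := by
    rw [he]; ring
  rw [e1]
  calc |-h ^ 3 / 2 + (1 + h) * e| ≤ |-h ^ 3 / 2| + |(1 + h) * e| := abs_add_le _ _
    _ = |h| ^ 3 / 2 + |1 + h| * |e| := by rw [abs_mul, abs_div, abs_neg, abs_pow]; norm_num
    _ ≤ |h| ^ 3 / 2 + (3 / 2) * (2 * |h| ^ 3) := by
        gcongr
        exact (abs_add_le _ _).trans (by rw [abs_one]; linarith)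
    _ ≤ 4 * |h| ^ 3 := by nlinarith [pow_nonneg (abs_nonneg h) 3]

/-! ### The largest generalized eigenvalue of `H` relative to `F` -/

section

open Matrix
open scoped MatrixOrder

variable {n : Type*} [Fintype n] [DecidableEq n]

lemma isHermitian_matrixSqrt (A : Matrix n n ℝ) : (matrixSqrt A).IsHermitian :=
  cfc_predicate Real.sqrt A

lemma matrixSqrt_mul_self {A : Matrix n n ℝ} (hA : A.PosSemidef) :
    matrixSqrt A * matrixSqrt A = A := by
  have hsa : IsSelfAdjoint A := hA.1
  unfold matrixSqrt
  rw [← cfc_mul Real.sqrt Real.sqrt A (by fun_prop) (by fun_prop)]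
  conv_rhs => rw [← cfc_id ℝ A]
  refine cfc_congr fun x hx => ?_
  rw [hA.1.spectrum_real_eq_range_eigenvalues] at hx
  obtain ⟨i, rfl⟩ := hx
  exact Real.mul_self_sqrt (hA.eigenvalues_nonneg i)

/-- The spectrum is finite, and nonempty because the index type is, so the supremum is attained. -/
lemma isGreatest_maxEigenvalue [Nonempty n] {M : Matrix n n ℝ} (hM : M.IsHermitian) :
    IsGreatest (spectrum ℝ M) (maxEigenvalue M) := by
  have h : {c : ℝ | Module.End.HasEigenvalue (Matrix.toLin' M) c} = spectrum ℝ M := by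
    ext c
    rw [Set.mem_ofPred_eq, Module.End.hasEigenvalue_iff_mem_spectrum, Matrix.spectrum_toLin']
  have hne : (spectrum ℝ M).Nonempty := by
    rw [hM.spectrum_real_eq_range_eigenvalues]
    exact Set.range_nonempty _
  unfold maxEigenvalue
  rw [h]
  exact ⟨hne.csSup_mem M.finite_real_spectrum,
    fun c hc => le_csSup M.finite_real_spectrum.bddAbove hc⟩

lemma dotProduct_mulVec_le_maxEigenvalue [Nonempty n] {M : Matrix n n ℝ} (hM : M.IsHermitian)
    (w : n → ℝ) : w ⬝ᵥ (M *ᵥ w) ≤ maxEigenvalue M * (w ⬝ᵥ w) := by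
  have h : (algebraMap ℝ (Matrix n n ℝ) (maxEigenvalue M) - M).PosSemidef := by
    rw [posSemidef_iff_isHermitian_and_spectrum_nonneg]
    refine ⟨IsHermitian.sub ?_ hM, ?_⟩
    · exact (IsSelfAdjoint.all (maxEigenvalue M)).algebraMap (Matrix n n ℝ)
    · rw [← spectrum.singleton_sub_eq]
      rintro _ ⟨a, rfl, b, hb, rfl⟩
      exact sub_nonneg.2 ((isGreatest_maxEigenvalue hM).2 hb)
  have := h.dotProduct_mulVec_nonneg w
  rw [sub_mulVec, dotProduct_sub, Algebra.algebraMap_eq_smul_one, smul_mulVec, one_mulVec,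
    dotProduct_smul, star_trivial, smul_eq_mul] at this
  linarith

variable {H F : Matrix n n ℝ}

lemma exists_mulVec_eq_maxEigenvalue_smul [Nonempty n] {M : Matrix n n ℝ} (hM : M.IsHermitian) :
    ∃ w ≠ 0, M *ᵥ w = maxEigenvalue M • w := by
  have h := (isGreatest_maxEigenvalue hM).1
  rw [← Matrix.spectrum_toLin', ← Module.End.hasEigenvalue_iff_mem_spectrum] at h
  obtain ⟨w, hw⟩ := h.exists_hasEigenvector
  exact ⟨w, hw.2, by simpa using hw.apply_eq_smul⟩

lemma posSemidef_sqrt_mul_inv_mul_sqrt (hF : F.PosDef) :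
    (matrixSqrt H * F⁻¹ * matrixSqrt H).PosSemidef := by
  have := hF.posSemidef.inv.conjTranspose_mul_mul_same (matrixSqrt H)
  rwa [(isHermitian_matrixSqrt H).eq] at this

/-- Otherwise the form of `F⁻¹` would vanish at `√H w` for every `w`. Definiteness then gives `√H =
0`, hence `H = 0`. -/
lemma maxEigenvalue_sqrt_mul_inv_mul_sqrt_pos (hH : H.PosSemidef) (hH0 : H ≠ 0)
    (hF : F.PosDef) : 0 < maxEigenvalue (matrixSqrt H * F⁻¹ * matrixSqrt H) := by
  have hne : Nonempty n := by
    by_contra h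
    rw [not_nonempty_iff] at h
    exact hH0 (Subsingleton.elim _ _)
  have hM := posSemidef_sqrt_mul_inv_mul_sqrt (H := H) hF
  by_contra! hle
  apply hH0
  rw [← matrixSqrt_mul_self hH]
  suffices h : matrixSqrt H = 0 by rw [h, zero_mul]
  refine Matrix.toLin'.injective (LinearMap.ext fun w => ?_)
  have h1 := dotProduct_mulVec_le_maxEigenvalue hM.1 w
  have h2 : 0 ≤ w ⬝ᵥ w := by simpa using dotProduct_star_self_nonneg w
  have h3 := hF.inv.posSemidef.dotProduct_mulVec_nonneg (matrixSqrt H *ᵥ w)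
  have e : w ⬝ᵥ ((matrixSqrt H * F⁻¹ * matrixSqrt H) *ᵥ w) =
      star (matrixSqrt H *ᵥ w) ⬝ᵥ (F⁻¹ *ᵥ (matrixSqrt H *ᵥ w)) := by
    rw [star_mulVec, (isHermitian_matrixSqrt H).eq, star_trivial, ← dotProduct_mulVec,
      mulVec_mulVec, mulVec_mulVec, mul_assoc]
  have h4 : star (matrixSqrt H *ᵥ w) ⬝ᵥ (F⁻¹ *ᵥ (matrixSqrt H *ᵥ w)) = 0 := by
    refine le_antisymm ?_ h3
    rw [← e]
    nlinarith
  rw [toLin'_apply, map_zero, LinearMap.zero_apply]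
  by_contra hne
  exact (hF.inv.dotProduct_mulVec_pos hne).ne' h4

/-- The largest eigenvalue of `√H F⁻¹ √H` is the largest generalized eigenvalue of `H` relative
to `F`. -/
lemma exists_mulVec_eq_maxEigenvalue_smul_mulVec (hH : H.PosSemidef) (hH0 : H ≠ 0)
    (hF : F.PosDef) :
    ∃ u ≠ 0, H *ᵥ u = maxEigenvalue (matrixSqrt H * F⁻¹ * matrixSqrt H) • (F *ᵥ u) := by
  have hne : Nonempty n := by
    by_contra h
    rw [not_nonempty_iff] at h
    exact hH0 (Subsingleton.elim _ _)
  have hσ := maxEigenvalue_sqrt_mul_inv_mul_sqrt_pos hH hH0 hF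
  have hM := posSemidef_sqrt_mul_inv_mul_sqrt (H := H) hF
  obtain ⟨w, hw0, hw⟩ := exists_mulVec_eq_maxEigenvalue_smul hM.1
  have hdet : IsUnit F.det := hF.det_pos.ne'.isUnit
  refine ⟨F⁻¹ *ᵥ (matrixSqrt H *ᵥ w), fun h => ?_, ?_⟩
  · refine smul_ne_zero hσ.ne' hw0 ?_
    rw [← hw, mul_assoc, ← mulVec_mulVec, ← mulVec_mulVec, h, mulVec_zero]
  · rw [mulVec_mulVec (M := F), mul_nonsing_inv _ hdet, one_mulVec, ← mulVec_smul, ← hw]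
    rw [mul_assoc (matrixSqrt H), ← mulVec_mulVec w (matrixSqrt H), mulVec_mulVec _ (matrixSqrt H),
      matrixSqrt_mul_self hH, ← mulVec_mulVec]

/-- Put a = √H v and z = F⁻¹√H a. The form of F is nonnegative at σv - z, its cross terms are a·a,
and zᵀFz = aᵀ(√H F⁻¹√H)a ≤ σ a·a. Together these give σ(σ vᵀFv - a·a) ≥ 0, where a·a = vᵀHv. -/
lemma dotProduct_mulVec_le_maxEigenvalue_mul (hH : H.PosSemidef) (hH0 : H ≠ 0)
    (hF : F.PosDef) (v : n → ℝ) :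
    v ⬝ᵥ (H *ᵥ v) ≤ maxEigenvalue (matrixSqrt H * F⁻¹ * matrixSqrt H) * (v ⬝ᵥ (F *ᵥ v)) := by
  set σ := maxEigenvalue (matrixSqrt H * F⁻¹ * matrixSqrt H)
  have hM := posSemidef_sqrt_mul_inv_mul_sqrt (H := H) hF
  have hdet : IsUnit F.det := hF.det_pos.ne'.isUnit
  have hF' : Fᵀ = F := by simpa using hF.1.eq
  have hA' : (matrixSqrt H)ᵀ = matrixSqrt H := by simpa using (isHermitian_matrixSqrt H).eq
  have hσ : 0 < σ := maxEigenvalue_sqrt_mul_inv_mul_sqrt_pos hH hH0 hF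
  have hne : Nonempty n := by
    by_contra h
    rw [not_nonempty_iff] at h
    exact hH0 (Subsingleton.elim _ _)
  set a := matrixSqrt H *ᵥ v with ha
  set z := F⁻¹ *ᵥ (matrixSqrt H *ᵥ a) with hz
  have hvv : v ⬝ᵥ (H *ᵥ v) = a ⬝ᵥ a := by
    conv_lhs => rw [← matrixSqrt_mul_self hH]
    rw [← mulVec_mulVec, dotProduct_mulVec, ← mulVec_transpose, hA']
  have hFz : F *ᵥ z = matrixSqrt H *ᵥ a := by
    rw [hz, mulVec_mulVec, mul_nonsing_inv _ hdet, one_mulVec]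
  have hvz : v ⬝ᵥ (F *ᵥ z) = a ⬝ᵥ a := by
    rw [hFz, dotProduct_mulVec, ← mulVec_transpose, hA']
  have hzv : z ⬝ᵥ (F *ᵥ v) = a ⬝ᵥ a := by
    rw [dotProduct_mulVec, ← mulVec_transpose, hF', dotProduct_comm, hvz]
  have hzz : z ⬝ᵥ (F *ᵥ z) ≤ σ * (a ⬝ᵥ a) := by
    refine le_of_eq_of_le ?_ (dotProduct_mulVec_le_maxEigenvalue hM.1 a)
    rw [hFz, dotProduct_mulVec, ← mulVec_transpose, hA', dotProduct_comm, hz]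
    simp only [mulVec_mulVec, mul_assoc]
  rw [hvv]
  have h1 := hF.posSemidef.dotProduct_mulVec_nonneg (σ • v - z)
  rw [star_trivial, mulVec_sub, mulVec_smul] at h1
  simp only [dotProduct_sub, sub_dotProduct, smul_dotProduct, dotProduct_smul, smul_eq_mul,
    hvz, hzv] at h1
  have h2 : 0 ≤ σ * (σ * (v ⬝ᵥ (F *ᵥ v)) - a ⬝ᵥ a) := by nlinarith
  nlinarith [nonneg_of_mul_nonneg_right h2 hσ]

end

/-! ### Likelihood maximization in an affine model -/

/-- The likelihood of `q` for data with empirical distribution `Q`, normalized per trial. -/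
def weightedLikelihood {Ω : Type*} [Fintype Ω] (Q q : Ω → ℝ) : ℝ := ∏ ω, q ω ^ Q ω

/-- A family of distributions depending affinely on a parameter in a compact convex set. -/
structure IsAffineModel {V Ω : Type*} [AddCommGroup V] [Module ℝ V] [TopologicalSpace V]
    [Fintype Ω] (S : Set V) (p : V → Ω → ℝ) : Prop where
  isCompact : IsCompact S
  convex : Convex ℝ S
  continuousOn : ContinuousOn p S
  mem_stdSimplex : ∀ t ∈ S, p t ∈ stdSimplex ℝ Ω
  segment : ∀ t ∈ S, ∀ u ∈ S, ∀ c : ℝ, p ((1 - c) • t + c • u) = (1 - c) • p t + c • p u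

section

variable {Ω : Type*} [Fintype Ω] {N : ℕ} {Q q : Ω → ℝ}

lemma weightedLikelihood_nonneg (hq : ∀ ω, 0 ≤ q ω) : 0 ≤ weightedLikelihood Q q :=
  Finset.prod_nonneg fun ω _ => Real.rpow_nonneg (hq ω) _

/-- Since 0 ^ 0 = 1 for real powers, outcomes not charged by `Q` contribute nothing, and positivity
is needed only where `Q` is nonzero. -/
lemma weightedLikelihood_eq_exp (hq : ∀ ω, Q ω ≠ 0 → 0 < q ω) :
    weightedLikelihood Q q = Real.exp (∑ ω, Q ω * Real.log (q ω)) := by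
  rw [Real.exp_sum]
  refine Finset.prod_congr rfl fun ω _ => ?_
  by_cases h : Q ω = 0
  · simp [h]
  · rw [Real.rpow_def_of_pos (hq ω h), mul_comm]

lemma pos_of_weightedLikelihood_pos (hq : ∀ ω, 0 ≤ q ω) (h : 0 < weightedLikelihood Q q) {ω : Ω}
    (hω : Q ω ≠ 0) : 0 < q ω := by
  refine (hq ω).lt_of_ne fun h0 => h.ne' ?_
  refine Finset.prod_eq_zero (Finset.mem_univ ω) ?_
  rw [← h0, Real.zero_rpow hω]

lemma iid_eq_weightedLikelihood_pow (hN : 0 < N) (hq : ∀ ω, 0 ≤ q ω) (x : Fin N → Ω) :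
    iid q x = weightedLikelihood (emp x) q ^ N := by
  classical
  have hN' : (N : ℝ) ≠ 0 := by positivity
  rw [weightedLikelihood, ← Finset.prod_pow, iid, ← Finset.prod_fiberwise Finset.univ x]
  refine Finset.prod_congr rfl fun ω _ => ?_
  rw [Finset.prod_congr rfl (g := fun _ => q ω) (by simp +contextual), Finset.prod_const,
    ← Real.rpow_mul_natCast (hq ω), emp, div_mul_cancel₀ _ hN', Real.rpow_natCast]

variable {V : Type*} [AddCommGroup V] [Module ℝ V] [TopologicalSpace V] {S : Set V}
  {p : V → Ω → ℝ}

namespace IsAffineModel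

lemma isMaxOn_weightedLikelihood (hM : IsAffineModel S p) (hN : 0 < N) {x : Fin N → Ω} {t : V}
    (ht : t ∈ S) (h : IsMaxOn (fun t => iid (p t) x) S t) :
    IsMaxOn (fun t => weightedLikelihood (emp x) (p t)) S t := by
  intro u hu
  have := h hu
  simp only [Set.mem_ofPred_eq] at this ⊢
  rw [iid_eq_weightedLikelihood_pow hN (hM.mem_stdSimplex u hu).1,
    iid_eq_weightedLikelihood_pow hN (hM.mem_stdSimplex t ht).1] at this
  exact (pow_le_pow_iff_left₀ (weightedLikelihood_nonneg (hM.mem_stdSimplex u hu).1)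
    (weightedLikelihood_nonneg (hM.mem_stdSimplex t ht).1) hN.ne').1 this

lemma exists_isMaxOn (hM : IsAffineModel S p) (hS : S.Nonempty) (hQ : ∀ ω, 0 ≤ Q ω) :
    ∃ t ∈ S, IsMaxOn (fun t => weightedLikelihood Q (p t)) S t := by
  refine hM.isCompact.exists_isMaxOn hS ?_
  refine continuousOn_finsetProd _ fun ω _ => ?_
  exact ((continuous_apply ω).comp_continuousOn hM.continuousOn).rpow_const fun _ _ =>
    Or.inr (hQ ω)

/-- The competitor `u` has positive likelihood, so the maximizer has too, and no factor charged by
`Q` can vanish. -/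
lemma pos_of_isMaxOn (hM : IsAffineModel S p) {t u : V} (ht : t ∈ S) (hu : u ∈ S)
    (hpos : ∀ ω, Q ω ≠ 0 → p u ω ≠ 0)
    (h : IsMaxOn (fun t => weightedLikelihood Q (p t)) S t) {ω : Ω} (hω : Q ω ≠ 0) :
    0 < p t ω := by
  refine pos_of_weightedLikelihood_pos (hM.mem_stdSimplex t ht).1 (lt_of_lt_of_le ?_ (h hu)) hω
  simp only
  rw [weightedLikelihood_eq_exp fun ω hω =>
    ((hM.mem_stdSimplex u hu).1 ω).lt_of_ne' (hpos ω hω)]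
  exact Real.exp_pos _

/-- First order optimality of a maximizer of the likelihood. -/
lemma sum_mul_div_le_one (hM : IsAffineModel S p) (hQ : Q ∈ stdSimplex ℝ Ω) {t u : V}
    (ht : t ∈ S) (hu : u ∈ S) (hpos : ∀ ω, Q ω ≠ 0 → 0 < p t ω)
    (h : IsMaxOn (fun t => weightedLikelihood Q (p t)) S t) :
    ∑ ω, Q ω * (p u ω / p t ω) ≤ 1 := by
  set y : Ω → ℝ := fun ω => p u ω / p t ω - 1 with hy
  suffices hs : ∑ ω, Q ω * y ω ≤ 0 by
    simp only [hy, mul_sub, Finset.sum_sub_distrib, mul_one, hQ.2] at hs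
    linarith
  -- Moving a fraction c from t towards u multiplies p_t by 1 + cy. Maximality and 1 - 1/x ≤ log x
  -- bound the increment from one side, so letting c decrease to 0 replaces a differentiation.
  have hc : ∀ c ∈ Set.Ioo (0 : ℝ) 1, ∑ ω, Q ω * (y ω / (1 + c * y ω)) ≤ 0 := by
    intro c ⟨hc0, hc1⟩
    have hmem : (1 - c) • t + c • u ∈ S :=
      hM.convex ht hu (by linarith) hc0.le (by ring)
    have hpc : ∀ ω, Q ω ≠ 0 → p ((1 - c) • t + c • u) ω = p t ω * (1 + c * y ω) := by
      intro ω hω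
      rw [hM.segment t ht u hu]
      have := (hpos ω hω).ne'
      simp only [Pi.add_apply, Pi.smul_apply, smul_eq_mul, hy]
      field_simp
      ring
    have hy1 : ∀ ω, Q ω ≠ 0 → 0 < 1 + c * y ω := by
      intro ω hω
      have : 0 ≤ p u ω / p t ω := div_nonneg ((hM.mem_stdSimplex u hu).1 ω) (hpos ω hω).le
      simp only [hy]
      nlinarith
    have h1 := h hmem
    simp only [Set.mem_ofPred_eq] at h1
    rw [weightedLikelihood_eq_exp hpos, weightedLikelihood_eq_exp fun ω hω => by
      rw [hpc ω hω]; exact mul_pos (hpos ω hω) (hy1 ω hω), Real.exp_le_exp] at h1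
    have h2 : c * ∑ ω, Q ω * (y ω / (1 + c * y ω)) ≤ 0 := by
      refine le_trans ?_ (sub_nonpos.2 h1)
      rw [Finset.mul_sum, ← Finset.sum_sub_distrib]
      refine Finset.sum_le_sum fun ω _ => ?_
      by_cases hω : Q ω = 0
      · simp [hω]
      rw [hpc ω hω, Real.log_mul (hpos ω hω).ne' (hy1 ω hω).ne']
      have h3 := Real.one_sub_inv_le_log_of_pos (hy1 ω hω)
      have h4 : c * (y ω / (1 + c * y ω)) = 1 - (1 + c * y ω)⁻¹ := by
        have := (hy1 ω hω).ne'
        field_simp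
        ring
      have h5 := mul_le_mul_of_nonneg_left h3 (hQ.1 ω)
      rw [← h4] at h5
      linarith
    exact nonpos_of_mul_nonpos_right h2 hc0
  have hlim : Tendsto (fun c : ℝ => ∑ ω, Q ω * (y ω / (1 + c * y ω))) (𝓝[>] 0)
      (𝓝 (∑ ω, Q ω * y ω)) := by
    refine tendsto_nhdsWithin_of_tendsto_nhds ?_
    refine tendsto_finsetSum _ fun ω _ => ?_
    have : ContinuousAt (fun c : ℝ => Q ω * (y ω / (1 + c * y ω))) 0 := by
      refine continuousAt_const.mul (continuousAt_const.div (by fun_prop) (by simp))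
    simpa [ContinuousAt] using this
  refine le_of_tendsto hlim ?_
  filter_upwards [Ioo_mem_nhdsGT (show (0 : ℝ) < 1 by norm_num)] with c hc' using hc c hc'

end IsAffineModel

/-- Two distributions which are nearly optimal for nearly the same weights are close. -/
lemma exists_forall_abs_sub_lt {Q₀ q₀ : Ω → ℝ} (hQ₀ : Q₀ ∈ stdSimplex ℝ Ω)
    (hq₀ : q₀ ∈ stdSimplex ℝ Ω) (hsupp : ∀ ω, Q₀ ω = 0 ↔ q₀ ω = 0) {ε : ℝ} (hε : 0 < ε) :
    ∃ κ > 0, ∀ Q ∈ stdSimplex ℝ Ω, ∀ q ∈ stdSimplex ℝ Ω, (∀ ω, |Q ω - Q₀ ω| < κ) →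
      (∀ ω, Q ω ≠ 0 → 0 < q ω) →
      ∑ ω, Q₀ ω * (q ω / q₀ ω) ≤ 1 → ∑ ω, Q ω * (q₀ ω / q ω) ≤ 1 → ∀ ω, |q ω - q₀ ω| < ε := by
  classical
  set k : ℝ := (Fintype.card Ω : ℝ) with hk
  have hk0 : 0 ≤ k := by positivity
  obtain ⟨α, hα, hα1, hαQ⟩ : ∃ α : ℝ, 0 < α ∧ α ≤ 1 ∧ ∀ ω, Q₀ ω ≠ 0 → α ≤ Q₀ ω ∧ α ≤ q₀ ω := by
    have : ∀ᶠ α : ℝ in 𝓝[>] 0, 0 < α ∧ α ≤ 1 ∧ ∀ ω, Q₀ ω ≠ 0 → α ≤ Q₀ ω ∧ α ≤ q₀ ω := by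
      refine eventually_mem_nhdsWithin.and ((eventually_nhdsWithin_of_eventually_nhds
        (eventually_le_nhds one_pos)).and ?_)
      rw [eventually_all]
      intro ω
      by_cases h : Q₀ ω = 0
      · simp [h]
      · have h1 : 0 < Q₀ ω := (hQ₀.1 ω).lt_of_ne' h
        have h2 : 0 < q₀ ω := (hq₀.1 ω).lt_of_ne' fun h' => h ((hsupp ω).2 h')
        filter_upwards [eventually_nhdsWithin_of_eventually_nhds (eventually_le_nhds h1),
          eventually_nhdsWithin_of_eventually_nhds (eventually_le_nhds h2)] with a ha hb _
        exact ⟨ha, hb⟩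
    exact this.exists
  -- Off the support of Q₀, the mass of q is what q loses on the support compared with q₀, which is
  -- at most kε' < ε.
  set ε' := ε / (k + 1) with hε'
  have hε'0 : 0 < ε' := by positivity
  -- The first bound keeps Q ≥ α/2 on the support of Q₀. The second makes 2kκ/α, the cost of
  -- replacing Q by Q₀ in the second optimality condition, smaller than α²ε'².
  refine ⟨min (α / 2) (ε' ^ 2 * α ^ 3 / (2 * k + 1)), by positivity, ?_⟩
  intro Q hQ q hq hnear hpos h1 h2
  set κ := min (α / 2) (ε' ^ 2 * α ^ 3 / (2 * k + 1))
  have hκ0 : 0 < κ := by positivity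
  have hκ1 : κ ≤ α / 2 := min_le_left _ _
  have hκ2 : 2 * k * κ < ε' ^ 2 * α ^ 3 := by
    have h3 : κ * (2 * k + 1) ≤ ε' ^ 2 * α ^ 3 :=
      (le_div_iff₀ (by positivity)).1 (min_le_right _ _)
    linarith
  have hQpos : ∀ ω, Q₀ ω ≠ 0 → α / 2 ≤ Q ω := fun ω hω => by
    have := abs_lt.1 (hnear ω)
    linarith [(hαQ ω hω).1]
  have hqpos : ∀ ω, Q₀ ω ≠ 0 → 0 < q ω := fun ω hω =>
    hpos ω (by linarith [hQpos ω hω] : 0 < Q ω).ne'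
  have hterm : ∀ ω, 0 ≤ Q ω * (q₀ ω / q ω) := fun ω =>
    mul_nonneg (hQ.1 ω) (div_nonneg (hq₀.1 ω) (hq.1 ω))
  have hqlow : ∀ ω, Q₀ ω ≠ 0 → q₀ ω / q ω ≤ 2 / α := by
    intro ω hω
    have h3 : Q ω * (q₀ ω / q ω) ≤ 1 :=
      (Finset.single_le_sum (f := fun ω => Q ω * (q₀ ω / q ω)) (fun i _ => hterm i)
        (Finset.mem_univ ω)).trans h2
    rw [le_div_iff₀ hα]
    nlinarith [hQpos ω hω, div_nonneg (hq₀.1 ω) (hq.1 ω)]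
  have hsum : ∑ ω, Q₀ ω * (q₀ ω / q ω) ≤ 1 + 2 * k * κ / α := by
    have h3 : ∀ ω, Q₀ ω * (q₀ ω / q ω) ≤ Q ω * (q₀ ω / q ω) + κ * (2 / α) := by
      intro ω
      by_cases hω : Q₀ ω = 0
      · rw [hω, zero_mul]
        have := hterm ω
        positivity
      · have h4 := (abs_lt.1 (hnear ω)).1
        have h5 := hqlow ω hω
        have h6 : 0 ≤ q₀ ω / q ω := div_nonneg (hq₀.1 ω) (hq.1 ω)
        have h7 : κ * (q₀ ω / q ω) ≤ κ * (2 / α) := mul_le_mul_of_nonneg_left h5 hκ0.le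
        nlinarith
    calc _ ≤ ∑ ω, (Q ω * (q₀ ω / q ω) + κ * (2 / α)) := Finset.sum_le_sum fun ω _ => h3 ω
      _ = ∑ ω, Q ω * (q₀ ω / q ω) + k * (κ * (2 / α)) := by
        rw [Finset.sum_add_distrib, Finset.sum_const, Finset.card_univ, nsmul_eq_mul]
      _ ≤ 1 + k * (κ * (2 / α)) := by gcongr
      _ = _ := by ring
  have hon : ∀ ω, Q₀ ω ≠ 0 → |q ω - q₀ ω| < ε' := by
    intro ω hω
    -- Adding the two optimality conditions with weights Q₀ leaves q/q₀ + q₀/q - 2 = (q - q₀)²/(q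
    -- q₀), which dominates (q - q₀)² because q and q₀ are at most 1.
    have hf : ∀ ω, Q₀ ω * ((q ω - q₀ ω) ^ 2) ≤
        Q₀ ω * (q ω / q₀ ω + q₀ ω / q ω - 2) := by
      intro ω
      by_cases hω : Q₀ ω = 0
      · simp [hω]
      have ha := hqpos ω hω
      have hb : 0 < q₀ ω := lt_of_lt_of_le hα (hαQ ω hω).2
      refine mul_le_mul_of_nonneg_left ?_ (hQ₀.1 ω)
      have e : q ω / q₀ ω + q₀ ω / q ω - 2 = (q ω - q₀ ω) ^ 2 / (q ω * q₀ ω) := by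
        field_simp
        ring
      rw [e, le_div_iff₀ (by positivity)]
      have h5 : q ω * q₀ ω ≤ 1 := mul_le_one₀ (le_one_of_mem_stdSimplex hq ω) hb.le
        (le_one_of_mem_stdSimplex hq₀ ω)
      nlinarith [sq_nonneg (q ω - q₀ ω)]
    have h3 : Q₀ ω * ((q ω - q₀ ω) ^ 2) ≤ 2 * k * κ / α := by
      calc _ ≤ ∑ ω, Q₀ ω * ((q ω - q₀ ω) ^ 2) :=
            Finset.single_le_sum (f := fun ω => Q₀ ω * ((q ω - q₀ ω) ^ 2))
              (fun i _ => mul_nonneg (hQ₀.1 i) (sq_nonneg _)) (Finset.mem_univ ω)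
        _ ≤ ∑ ω, Q₀ ω * (q ω / q₀ ω + q₀ ω / q ω - 2) := Finset.sum_le_sum fun ω _ => hf ω
        _ = ∑ ω, Q₀ ω * (q ω / q₀ ω) + ∑ ω, Q₀ ω * (q₀ ω / q ω) - 2 := by
          simp only [mul_sub, mul_add, Finset.sum_sub_distrib, Finset.sum_add_distrib,
            ← Finset.sum_mul, hQ₀.2, one_mul]
        _ ≤ _ := by linarith
    have h4 : (q ω - q₀ ω) ^ 2 < ε' ^ 2 := by
      rw [le_div_iff₀ hα] at h3
      have h5 : α * (q ω - q₀ ω) ^ 2 ≤ Q₀ ω * (q ω - q₀ ω) ^ 2 := by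
        gcongr
        exact (hαQ ω hω).1
      have h6 : α ^ 2 * (q ω - q₀ ω) ^ 2 < α ^ 2 * ε' ^ 2 := by
        have : α ^ 3 ≤ α ^ 2 := pow_le_pow_of_le_one hα.le hα1 (by norm_num)
        nlinarith [mul_le_mul_of_nonneg_left this (sq_nonneg ε')]
      exact lt_of_mul_lt_mul_left h6 (by positivity)
    exact abs_lt_of_sq_lt_sq h4 hε'0.le
  have hε'' : k * ε' + ε' = ε := by rw [hε']; field_simp
  intro ω
  by_cases hω : Q₀ ω = 0
  · have h0 : q₀ ω = 0 := (hsupp ω).1 hω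
    rw [h0, sub_zero, abs_of_nonneg (hq.1 ω)]
    have h3 : q ω ≤ ∑ ω with Q₀ ω = 0, q ω :=
      Finset.single_le_sum (fun i _ => hq.1 i) (by simpa using hω)
    have h4 : ∑ ω with Q₀ ω = 0, q₀ ω = 0 :=
      Finset.sum_eq_zero fun ω hω => (hsupp ω).1 (Finset.mem_filter.1 hω).2
    have h5 := hq.2
    have h6 := hq₀.2
    rw [← Finset.sum_filter_add_sum_filter_not Finset.univ (fun ω => Q₀ ω = 0)] at h5 h6
    have h7 : ∑ ω with ¬ Q₀ ω = 0, q₀ ω - ∑ ω with ¬ Q₀ ω = 0, q ω ≤ k * ε' := by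
      rw [← Finset.sum_sub_distrib]
      calc _ ≤ ∑ ω with ¬ Q₀ ω = 0, ε' := Finset.sum_le_sum fun ω hω => by
            have := abs_lt.1 (hon ω (Finset.mem_filter.1 hω).2)
            linarith
        _ ≤ ∑ ω : Ω, ε' := Finset.sum_le_sum_of_subset_of_nonneg (Finset.filter_subset _ _)
            fun _ _ _ => hε'0.le
        _ = _ := by rw [Finset.sum_const, Finset.card_univ, nsmul_eq_mul]
    linarith
  · exact (hon ω hω).trans_le (by nlinarith)

namespace IsAffineModel

/-- On the compact complement of a neighbourhood of t₀, the distance from p to p t₀ attains its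
minimum, which is positive by injectivity. -/
lemma exists_forall_mem_of_abs_sub_lt (hM : IsAffineModel S p) (hinj : Set.InjOn p S) {t₀ : V}
    (ht₀ : t₀ ∈ S) {W : Set V} (hW : W ∈ 𝓝[S] t₀) :
    ∃ ε > 0, ∀ t ∈ S, (∀ ω, |p t ω - p t₀ ω| < ε) → t ∈ W := by
  obtain ⟨U, hU, htU, hUW⟩ := mem_nhdsWithin.1 hW
  rcases (S \ U).eq_empty_or_nonempty with h | h
  · exact ⟨1, one_pos, fun t ht _ => hUW ⟨Set.sdiff_eq_empty.1 h ht, ht⟩⟩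
  obtain ⟨a, ha, hmin⟩ := (hM.isCompact.diff hU).exists_isMinOn h
    (f := fun t => dist (p t) (p t₀))
    (continuous_dist.comp_continuousOn
      ((hM.continuousOn.mono Set.sdiff_subset).prodMk continuousOn_const))
  refine ⟨dist (p a) (p t₀), dist_pos.2 fun he => ?_, fun t ht hlt => ?_⟩
  · exact ha.2 (hinj ha.1 ht₀ he ▸ htU)
  · by_contra htW
    have htU' : t ∈ S \ U := ⟨ht, fun h' => htW (hUW ⟨h', ht⟩)⟩
    have h1 := hmin htU'
    have hpos : 0 < dist (p a) (p t₀) := dist_pos.2 fun he => ha.2 (hinj ha.1 ht₀ he ▸ htU)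
    have h2 : dist (p t) (p t₀) < dist (p a) (p t₀) :=
      (dist_pi_lt_iff hpos).2 fun ω => by rw [Real.dist_eq]; exact hlt ω
    exact absurd h1 (not_le.2 h2)

/-- Stability of maximum likelihood estimates with respect to the empirical distribution. -/
lemma exists_forall_isMaxOn_mem (hM : IsAffineModel S p) (hinj : Set.InjOn p S) {t₀ : V}
    (ht₀ : t₀ ∈ S) {Q₀ : Ω → ℝ} (hQ₀ : Q₀ ∈ stdSimplex ℝ Ω)
    (hsupp : ∀ ω, Q₀ ω = 0 ↔ p t₀ ω = 0)
    (hopt : ∀ t ∈ S, ∑ ω, Q₀ ω * (p t ω / p t₀ ω) ≤ 1) {W : Set V} (hW : W ∈ 𝓝[S] t₀) :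
    ∃ κ > 0, ∀ Q ∈ stdSimplex ℝ Ω, (∀ ω, |Q ω - Q₀ ω| < κ) → (∀ ω, p t₀ ω = 0 → Q ω = 0) →
      ∀ t ∈ S, IsMaxOn (fun t => weightedLikelihood Q (p t)) S t → t ∈ W := by
  obtain ⟨ε, hε, hεW⟩ := hM.exists_forall_mem_of_abs_sub_lt hinj ht₀ hW
  obtain ⟨κ, hκ, hκε⟩ := exists_forall_abs_sub_lt hQ₀ (hM.mem_stdSimplex t₀ ht₀) hsupp hε
  refine ⟨κ, hκ, fun Q hQ hnear hac t ht hmax => hεW t ht ?_⟩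
  have hpos : ∀ ω, Q ω ≠ 0 → 0 < p t ω := fun ω hω =>
    hM.pos_of_isMaxOn ht ht₀ (fun ω h h0 => h (hac ω h0)) hmax hω
  exact hκε Q hQ (p t) (hM.mem_stdSimplex t ht) hnear hpos (hopt t ht)
    (hM.sum_mul_div_le_one hQ ht ht₀ hpos hmax)

/-- This is the first order condition for p s as maximizer for its own weights. Only the mass of p t
off the support of p s is lost. -/
lemma sum_self_mul_div_le_one (hM : IsAffineModel S p) {s t : V} (ht : t ∈ S) :
    ∑ ω, p s ω * (p t ω / p s ω) ≤ 1 := by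
  rw [← (hM.mem_stdSimplex t ht).2]
  refine Finset.sum_le_sum fun ω _ => ?_
  by_cases h : p s ω = 0
  · rw [h, zero_mul]
    exact (hM.mem_stdSimplex t ht).1 ω
  · rw [mul_div_cancel₀ _ h]

end IsAffineModel

end

/-! ### Second order expansion of the pseudo-distance -/

/-- Second order Taylor expansion at a critical point. -/
lemma eventually_abs_sub_le_mul_norm_sq {E : Type*} [NormedAddCommGroup E] [NormedSpace ℝ E]
    {f : E → ℝ} {s : E} (hf : ContDiffAt ℝ 2 f s) (hcrit : fderiv ℝ f s = 0) {ε : ℝ}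
    (hε : 0 < ε) :
    ∀ᶠ v in 𝓝 (0 : E), |f (s + v) - f s - fderiv ℝ (fderiv ℝ f) s v v / 2| ≤ ε * ‖v‖ ^ 2 := by
  set B := fderiv ℝ (fderiv ℝ f) s with hB
  have hsymm : ∀ v w, B v w = B w v :=
    (hf.isSymmSndFDerivAt (by simp)).eq
  have hdiff : HasFDerivAt (fderiv ℝ f) B s :=
    ((hf.fderiv_right (m := 1) (by norm_num)).differentiableAt (by norm_num)).hasFDerivAt
  have htr : Tendsto (fun v => s + v) (𝓝 (0 : E)) (𝓝 s) := by
    have : ContinuousAt (fun v => s + v) (0 : E) := by fun_prop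
    simpa [ContinuousAt] using this
  have h1 : ∀ᶠ v in 𝓝 (0 : E), DifferentiableAt ℝ f (s + v) :=
    htr.eventually ((hf.eventually (by simp)).mono fun y hy => hy.differentiableAt (by norm_num))
  have h2 : ∀ᶠ v in 𝓝 (0 : E), ‖fderiv ℝ f (s + v) - B v‖ ≤ ε * ‖v‖ := by
    have := (hasFDerivAt_iff_isLittleO_nhds_zero.1 hdiff).def hε
    simpa [hcrit] using this
  obtain ⟨δ, hδ, hball⟩ := Metric.eventually_nhds_iff_ball.1 (h1.and h2)
  filter_upwards [Metric.ball_mem_nhds (0 : E) hδ] with v hv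
  have hsub : ∀ w ∈ Metric.closedBall (0 : E) ‖v‖, w ∈ Metric.ball (0 : E) δ := fun w hw => by
    simp only [mem_closedBall_zero_iff, mem_ball_zero_iff] at *
    linarith
  -- By symmetry of B, removing the quadratic part leaves the derivative Df(s+w) - Bw. Its bound
  -- ε‖v‖ on the ball of radius ‖v‖ becomes ε‖v‖² by the mean value inequality.
  have hder : ∀ w ∈ Metric.closedBall (0 : E) ‖v‖,
      HasFDerivWithinAt (fun w => f (s + w) - B w w / 2) (fderiv ℝ f (s + w) - B w)
        (Metric.closedBall (0 : E) ‖v‖) w := by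
    intro w hw
    have ha : HasFDerivAt (fun w => f (s + w)) (fderiv ℝ f (s + w)) w :=
      (hasFDerivAt_comp_add_left s).2 (hball w (hsub w hw)).1.hasFDerivAt
    have hb := ((B.hasFDerivAt (x := w)).clm_apply (hasFDerivAt_id w)).mul_const (2⁻¹ : ℝ)
    have hc := ha.sub hb
    refine (hc.congr_fderiv ?_).hasFDerivWithinAt.congr (fun y _ => ?_) ?_
    · ext y
      simp [hsymm y w]
      ring
    · simp [div_eq_mul_inv]
    · simp [div_eq_mul_inv]
  have hbound : ∀ w ∈ Metric.closedBall (0 : E) ‖v‖,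
      ‖fderiv ℝ f (s + w) - B w‖ ≤ ε * ‖v‖ := fun w hw =>
    (hball w (hsub w hw)).2.trans
      (mul_le_mul_of_nonneg_left (by simpa using hw) hε.le)
  have := (convex_closedBall (0 : E) ‖v‖).norm_image_sub_le_of_norm_hasFDerivWithin_le hder hbound
    (x := 0) (y := v) (by simp) (by simp)
  simp only [add_zero, map_zero, zero_div, sub_zero, Real.norm_eq_abs] at this
  calc _ = |f (s + v) - B v v / 2 - f s| := by congr 1; ring
    _ ≤ ε * ‖v‖ * ‖v‖ := this
    _ = _ := by ring

section

variable {d : ℕ}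

lemma sum_smul_single {n : Type*} [Fintype n] [DecidableEq n] (v : EuclideanSpace ℝ n) :
    ∑ i, v i • EuclideanSpace.single i (1 : ℝ) = v := by
  simpa using (EuclideanSpace.basisFun n ℝ).sum_repr v

lemma hesse_apply {Δ : Param d → Param d → ℝ} {s : Param d}
    (hf : ContDiffAt ℝ 2 (fun a => Δ a s) s) (α β : Fin (d ^ 2 - 1)) :
    hesse Δ s α β = fderiv ℝ (fderiv ℝ fun a => Δ a s) s (EuclideanSpace.single α 1)
      (EuclideanSpace.single β 1) := by
  have hdiff := ((hf.fderiv_right (m := 1) (by norm_num)).differentiableAt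
    (by norm_num)).hasFDerivAt
  have h := hdiff.clm_apply (hasFDerivAt_const (EuclideanSpace.single β (1 : ℝ)) s)
  simp [hesse, h.fderiv]

lemma dotProduct_hesse_mulVec {Δ : Param d → Param d → ℝ} {s : Param d}
    (hf : ContDiffAt ℝ 2 (fun a => Δ a s) s) (v : Param d) :
    v.ofLp ⬝ᵥ (hesse Δ s).mulVec v.ofLp = fderiv ℝ (fderiv ℝ fun a => Δ a s) s v v := by
  conv_rhs => rw [← sum_smul_single v]
  simp only [map_sum, map_smul, sum_apply, smul_apply,
    smul_eq_mul, dotProduct, Matrix.mulVec, hesse_apply hf, Finset.mul_sum]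
  rw [Finset.sum_comm]
  refine Finset.sum_congr rfl fun i _ => Finset.sum_congr rfl fun j _ => ?_
  ring

variable {Δ : Param d → Param d → ℝ} {S : Set (Param d)} {s : Param d}

/-- Second order expansion of a pseudo-distance at an interior point. -/
lemma eventually_abs_sub_hesse_le (hΔ : IsPseudoDistanceOn Δ S) (hs : s ∈ interior S)
    (hf : ContDiffAt ℝ 2 (fun a => Δ a s) s) {ε : ℝ} (hε : 0 < ε) :
    ∀ᶠ v in 𝓝 (0 : Param d),
      |Δ (s + v) s - v.ofLp ⬝ᵥ (hesse Δ s).mulVec v.ofLp / 2| ≤ ε * ‖v‖ ^ 2 := by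
  have hsS := interior_subset hs
  have hmin : IsLocalMin (fun a => Δ a s) s := by
    filter_upwards [mem_interior_iff_mem_nhds.1 hs] with a ha
    rw [hΔ.self_eq_zero s hsS]
    exact hΔ.nonneg a ha s hsS
  have := eventually_abs_sub_le_mul_norm_sq hf hmin.fderiv_eq_zero hε
  simpa only [hΔ.self_eq_zero s hsS, sub_zero, ← dotProduct_hesse_mulVec hf] using this

lemma tendsto_add_smul_nhds {E : Type*} [NormedAddCommGroup E] [NormedSpace ℝ E] (s u : E) :
    Tendsto (fun ε : ℝ => s + ε • u) (𝓝 0) (𝓝 s) := by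
  have : ContinuousAt (fun ε : ℝ => s + ε • u) 0 := by fun_prop
  simpa [ContinuousAt] using this

lemma tendsto_smul_nhds_zero {E : Type*} [NormedAddCommGroup E] [NormedSpace ℝ E] (u : E) :
    Tendsto (fun ε : ℝ => ε • u) (𝓝 0) (𝓝 0) := by
  simpa using tendsto_add_smul_nhds 0 u

lemma dotProduct_mulVec_smul_smul {n : Type*} [Fintype n] (A : Matrix n n ℝ) (c : ℝ)
    (v : EuclideanSpace ℝ n) :
    (c • v).ofLp ⬝ᵥ A.mulVec (c • v).ofLp = c ^ 2 * (v.ofLp ⬝ᵥ A.mulVec v.ofLp) := by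
  rw [WithLp.ofLp_smul, Matrix.mulVec_smul, smul_dotProduct, dotProduct_smul, smul_eq_mul,
    smul_eq_mul]
  ring

/-- The Hesse matrix of a pseudo-distance at an interior point is positive semidefinite. -/
lemma posSemidef_hesse (hΔ : IsPseudoDistanceOn Δ S) (hs : s ∈ interior S)
    (hf : ContDiffAt ℝ 2 (fun a => Δ a s) s) : (hesse Δ s).PosSemidef := by
  refine .of_dotProduct_mulVec_nonneg ?_ fun w => ?_
  · ext α β
    rw [Matrix.conjTranspose_apply, star_trivial, hesse_apply hf, hesse_apply hf]
    exact (hf.isSymmSndFDerivAt (by simp)).eq _ _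
  · rw [star_trivial]
    set v : Param d := WithLp.toLp 2 w
    change 0 ≤ v.ofLp ⬝ᵥ (hesse Δ s).mulVec v.ofLp
    refine le_of_forall_pos_le_add fun ε hε => ?_
    set η := ε / (2 * (‖v‖ ^ 2 + 1)) with hη
    have hη0 : 0 < η := by positivity
    have h1 := (tendsto_smul_nhds_zero v).eventually (eventually_abs_sub_hesse_le hΔ hs hf hη0)
    have h2 := (tendsto_add_smul_nhds s v).eventually (mem_interior_iff_mem_nhds.1 hs)
    obtain ⟨c, ⟨hc1, hc2⟩, hc0⟩ := ((eventually_nhdsWithin_of_eventually_nhds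
      (s := Set.Ioi (0 : ℝ)) (h1.and h2)).and eventually_mem_nhdsWithin).exists
    have hc0 : 0 < c := hc0
    rw [dotProduct_mulVec_smul_smul, norm_smul, mul_pow, Real.norm_eq_abs, sq_abs] at hc1
    have h3 := hΔ.nonneg _ hc2 s (interior_subset hs)
    have h4 := (abs_le.1 hc1).2
    have h5 : 0 ≤ c ^ 2 * (v.ofLp ⬝ᵥ (hesse Δ s).mulVec v.ofLp + 2 * (η * ‖v‖ ^ 2)) := by
      nlinarith
    have h6 := nonneg_of_mul_nonneg_right h5 (by positivity)
    have h7 : 2 * (η * ‖v‖ ^ 2) ≤ ε := by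
      rw [hη, div_mul_eq_mul_div, ← mul_div_assoc, div_le_iff₀ (by positivity)]
      nlinarith
    linarith

end

/-! ### Density operators, outcome probabilities and the Fisher matrix -/

section

open scoped MatrixOrder

lemma trace_mul_nonneg_of_posSemidef {n : Type*} [Fintype n] {A B : Matrix n n ℂ}
    (hA : A.PosSemidef) (hB : B.PosSemidef) : 0 ≤ (A * B).trace := by
  classical
  obtain ⟨C, rfl⟩ := CStarAlgebra.nonneg_iff_eq_star_mul_self.mp hA.nonneg
  rw [Matrix.star_eq_conjTranspose, mul_assoc, Matrix.trace_mul_comm]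
  exact (hB.mul_mul_conjTranspose_same C).trace_nonneg

/-- With A = C*C, an off-diagonal entry is bounded by the average of two squared column norms of C,
each at most the trace. This is what bounds the state space. -/
lemma norm_apply_le_trace_of_posSemidef {n : Type*} [Fintype n] {A : Matrix n n ℂ}
    (hA : A.PosSemidef) (i j : n) : ‖A i j‖ ≤ A.trace.re := by
  classical
  obtain ⟨C, rfl⟩ := CStarAlgebra.nonneg_iff_eq_star_mul_self.mp hA.nonneg
  have hle : ∀ l, ∑ k, ‖C k l‖ ^ 2 ≤ (star C * C).trace.re := by
    intro l
    have : (star C * C).trace.re = ∑ l, ∑ k, ‖C k l‖ ^ 2 := by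
      simp only [Matrix.trace, Matrix.diag, Matrix.mul_apply, Matrix.star_apply, Complex.re_sum,
        RCLike.star_def, Complex.conj_mul']
      norm_cast
    rw [this]
    exact Finset.single_le_sum (f := fun l => ∑ k, ‖C k l‖ ^ 2)
      (fun l _ => Finset.sum_nonneg fun k _ => sq_nonneg _) (Finset.mem_univ l)
  calc ‖(star C * C) i j‖ = ‖∑ k, star (C k i) * C k j‖ := by
        simp [Matrix.mul_apply]
    _ ≤ ∑ k, ‖C k i‖ * ‖C k j‖ := (norm_sum_le _ _).trans_eq (by simp)
    _ ≤ ∑ k, (‖C k i‖ ^ 2 + ‖C k j‖ ^ 2) / 2 := Finset.sum_le_sum fun k _ => by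
        nlinarith [sq_nonneg (‖C k i‖ - ‖C k j‖)]
    _ = (∑ k, ‖C k i‖ ^ 2 + ∑ k, ‖C k j‖ ^ 2) / 2 := by
        rw [← Finset.sum_add_distrib, Finset.sum_div]
    _ ≤ _ := by linarith [hle i, hle j]

end

section

variable {d : ℕ} {Ω : Type*} [Fintype Ω] {ρ : Param d →ᵃ[ℝ] Op d} {T : Ω → Op d}

/-- The linear part of the outcome probability of `x`. -/
def probLinear (ρ : Param d →ᵃ[ℝ] Op d) (T : Ω → Op d) (x : Ω) : Param d →L[ℝ] ℝ :=
  LinearMap.toContinuousLinearMap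
    { toFun := fun v => (ρ.linear v * T x).trace.re
      map_add' := fun v w => by simp [add_mul, Matrix.trace_add]
      map_smul' := fun c v => by simp [Matrix.trace_smul] }

omit [Fintype Ω] in
lemma prob_add (s v : Param d) (x : Ω) :
    prob ρ T (s + v) x = prob ρ T s x + probLinear ρ T x v := by
  have h : ρ (s + v) = ρ.linear v + ρ s := by
    have := ρ.map_vadd s v
    rwa [vadd_eq_add, vadd_eq_add, add_comm v s] at this
  simp only [prob, h, add_mul, Matrix.trace_add, Complex.add_re]
  rw [add_comm]
  rfl

omit [Fintype Ω] in
lemma prob_eq (s t : Param d) (x : Ω) :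
    prob ρ T t x = prob ρ T s x + probLinear ρ T x (t - s) := by
  rw [← prob_add, add_sub_cancel]

omit [Fintype Ω] in
lemma hasFDerivAt_prob (s : Param d) (x : Ω) :
    HasFDerivAt (fun t => prob ρ T t x) (probLinear ρ T x) s := by
  have h : (fun t => prob ρ T t x) = fun t => prob ρ T 0 x + probLinear ρ T x t := by
    funext t
    rw [← prob_add, zero_add]
  rw [h]
  exact (probLinear ρ T x).hasFDerivAt.const_add _

lemma isCompact_stateSpace (hρ : Function.Injective ρ) : IsCompact (stateSpace ρ) := by
  have hcont : Continuous ρ := by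
    rw [ρ.decomp]
    exact ρ.linear.continuous_of_finiteDimensional.add continuous_const
  have hclosed : IsClosed (stateSpace ρ) := by
    have h : stateSpace ρ = {s | (ρ s).conjTranspose = ρ s} ∩
        (⋂ w : Fin d → ℂ, {s | 0 ≤ star w ⬝ᵥ (ρ s).mulVec w}) ∩ {s | (ρ s).trace = 1} := by
      ext s
      simp only [stateSpace, densityOps, Set.mem_ofPred_eq, Set.mem_inter_iff, Set.mem_iInter,
        Matrix.posSemidef_iff_dotProduct_mulVec]
      rfl
    rw [h]
    refine ((isClosed_eq hcont.matrix_conjTranspose hcont).inter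
      (isClosed_iInter fun w => isClosed_le continuous_const ?_)).inter
      (isClosed_eq hcont.matrix_trace continuous_const)
    exact continuous_const.dotProduct (hcont.matrix_mulVec continuous_const)
  refine Metric.isCompact_of_isClosed_isBounded hclosed ?_
  -- As functions of two indices, operators carry the entrywise sup norm. Density operators differ
  -- by at most 2 in it, and the injective linear part is bounded below.
  let L : Param d →ₗ[ℝ] (Fin d → Fin d → ℂ) := ρ.linear
  have hker : LinearMap.ker L = ⊥ :=
    LinearMap.ker_eq_bot.2 (ρ.linear_injective_iff.2 hρ)
  obtain ⟨K, hK0, hK⟩ := L.exists_antilipschitzWith hker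
  rcases (stateSpace ρ).eq_empty_or_nonempty with h | ⟨s₀, hs₀⟩
  · rw [h]; exact Bornology.isBounded_empty
  refine (Metric.isBounded_iff_subset_closedBall s₀).2 ⟨K * 2, fun t ht => ?_⟩
  rw [Metric.mem_closedBall]
  refine (hK.le_mul_dist t s₀).trans ?_
  gcongr
  rw [dist_eq_norm, ← map_sub]
  have he : L (t - s₀) = fun i j => ρ t i j - ρ s₀ i j := by
    have := ρ.linearMap_vsub t s₀
    funext i j
    change ρ.linear (t - s₀) i j = _
    rw [← vsub_eq_sub t s₀, this]
    rfl
  rw [he]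
  refine (pi_norm_le_iff_of_nonneg (by norm_num)).2 fun i =>
    (pi_norm_le_iff_of_nonneg (by norm_num)).2 fun j => (norm_sub_le _ _).trans ?_
  have h1 := norm_apply_le_trace_of_posSemidef ht.1 i j
  have h2 := norm_apply_le_trace_of_posSemidef hs₀.1 i j
  rw [ht.2, Complex.one_re] at h1
  rw [hs₀.2, Complex.one_re] at h2
  linarith

lemma segment_apply (t u : Param d) (c : ℝ) :
    ρ ((1 - c) • t + c • u) = (1 - c) • ρ t + c • ρ u := by
  have := ρ.apply_lineMap t u c
  simp only [AffineMap.lineMap_apply_module] at this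
  exact this

lemma convex_stateSpace : Convex ℝ (stateSpace ρ) := by
  intro t ht u hu a b ha hb hab
  obtain rfl : a = 1 - b := by linarith
  have h := segment_apply (ρ := ρ) t u b
  refine ⟨?_, ?_⟩
  · rw [h]
    refine Matrix.PosSemidef.add ?_ ?_
    · exact ht.1.smul (by exact_mod_cast ha)
    · exact hu.1.smul hb
  · rw [h, Matrix.trace_add, Matrix.trace_smul, Matrix.trace_smul, ht.2, hu.2]
    rw [← add_smul, hab, one_smul]

lemma prob_mem_stdSimplex (hT : IsPOVM T) {s : Param d} (hs : s ∈ stateSpace ρ) :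
    prob ρ T s ∈ stdSimplex ℝ Ω := by
  refine ⟨fun x => ?_, ?_⟩
  · exact (Complex.nonneg_iff.1 (trace_mul_nonneg_of_posSemidef hs.1 (hT.posSemidef x))).1
  · simp only [prob]
    rw [← Complex.re_sum, ← Matrix.trace_sum, ← Finset.mul_sum, hT.sum_eq_one, mul_one, hs.2,
      Complex.one_re]

lemma isAffineModel_prob (hρ : IsParametrization ρ) (hT : IsPOVM T) :
    IsAffineModel (stateSpace ρ) (prob ρ T) where
  isCompact := isCompact_stateSpace hρ.injective
  convex := convex_stateSpace
  continuousOn := by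
    refine (continuous_pi fun x => ?_).continuousOn
    exact continuous_iff_continuousAt.2 fun s => (hasFDerivAt_prob s x).continuousAt
  mem_stdSimplex _ ht := prob_mem_stdSimplex hT ht
  segment t _ u _ c := by
    funext x
    simp only [prob, segment_apply, add_mul, Matrix.trace_add, Complex.add_re, Pi.add_apply,
      Pi.smul_apply, smul_mul_assoc, Matrix.trace_smul, Complex.smul_re]

lemma injOn_prob (hρ : IsParametrization ρ) (hT : IsPOVM T) (hIC : InformationallyComplete T) :
    Set.InjOn (prob ρ T) (stateSpace ρ) := by
  intro t ht u hu h
  refine hρ.injective (hIC _ ht _ hu fun x => ?_)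
  refine Complex.ext (congrFun h x) ?_
  rw [← (Complex.nonneg_iff.1 (trace_mul_nonneg_of_posSemidef ht.1 (hT.posSemidef x))).2,
    ← (Complex.nonneg_iff.1 (trace_mul_nonneg_of_posSemidef hu.1 (hT.posSemidef x))).2]

/-- An interior zero of the probability is a local minimum of an affine function, so the linear part
vanishes. -/
lemma probLinear_eq_zero (hT : IsPOVM T) {s : Param d} (hs : s ∈ interior (stateSpace ρ)) {x : Ω}
    (h : prob ρ T s x = 0) : probLinear ρ T x = 0 := by
  have hmin : IsLocalMin (fun t => prob ρ T t x) s := by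
    filter_upwards [mem_interior_iff_mem_nhds.1 hs] with t ht
    rw [h]
    exact (prob_mem_stdSimplex hT ht).1 x
  rw [← (hasFDerivAt_prob s x).fderiv]
  exact hmin.fderiv_eq_zero

lemma prob_eq_zero_of_mem_interior (hT : IsPOVM T) {s : Param d}
    (hs : s ∈ interior (stateSpace ρ)) {x : Ω} (h : prob ρ T s x = 0) (t : Param d) :
    prob ρ T t x = 0 := by
  rw [prob_eq s t, h, probLinear_eq_zero hT hs h]
  simp

/-- Outcomes of probability zero drop out on both sides: on the left by the factor `prob`, on the
right by division by zero. -/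
lemma dotProduct_fisher_mulVec (s v : Param d) :
    v.ofLp ⬝ᵥ (fisher ρ T s).mulVec v.ofLp = ∑ x, probLinear ρ T x v ^ 2 / prob ρ T s x := by
  have hlog : ∀ x (w : Param d), prob ρ T s x ≠ 0 →
      fderiv ℝ (fun t => Real.log (prob ρ T t x)) s w = probLinear ρ T x w / prob ρ T s x := by
    intro x w hx
    rw [((hasFDerivAt_prob s x).log hx).fderiv]
    simp [div_eq_inv_mul]
  have hlin : ∀ x, probLinear ρ T x v =
      ∑ α, v α * probLinear ρ T x (EuclideanSpace.single α 1) := by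
    intro x
    conv_lhs => rw [← sum_smul_single v]
    simp only [map_sum, map_smul, smul_eq_mul]
  simp only [dotProduct, Matrix.mulVec, fisher, Matrix.of_apply, Finset.mul_sum, Finset.sum_mul]
  rw [Finset.sum_congr rfl fun α _ => Finset.sum_comm, Finset.sum_comm]
  refine Finset.sum_congr rfl fun x _ => ?_
  by_cases hx : prob ρ T s x = 0
  · simp [hx]
  · rw [hlin x, sq (∑ α, _), Finset.sum_mul_sum, Finset.sum_div]
    refine Finset.sum_congr rfl fun α _ => ?_
    rw [Finset.sum_div]
    refine Finset.sum_congr rfl fun β _ => ?_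
    rw [hlog x _ hx, hlog x _ hx]
    field_simp

/-- The Fisher matrix is positive definite if the outcome probabilities separate directions. -/
lemma posDef_fisher (hT : IsPOVM T) {s : Param d} (hs : s ∈ interior (stateSpace ρ))
    (hinj : ∀ v, (∀ x, probLinear ρ T x v = 0) → v = 0) : (fisher ρ T s).PosDef := by
  refine .of_dotProduct_mulVec_pos ?_ fun w hw => ?_
  · ext α β
    rw [Matrix.conjTranspose_apply, star_trivial]
    simp only [fisher, Matrix.of_apply]
    exact Finset.sum_congr rfl fun x _ => by ring
  · rw [star_trivial]
    set v : Param d := WithLp.toLp 2 w with hv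
    change 0 < v.ofLp ⬝ᵥ (fisher ρ T s).mulVec v.ofLp
    rw [dotProduct_fisher_mulVec]
    have hp := (prob_mem_stdSimplex hT (interior_subset hs)).1
    refine (Finset.sum_nonneg fun x _ => div_nonneg (sq_nonneg _) (hp x)).lt_of_ne' fun h0 => ?_
    rw [Finset.sum_eq_zero_iff_of_nonneg fun x _ => div_nonneg (sq_nonneg _) (hp x)] at h0
    refine hw ?_
    have : v = 0 := hinj v fun x => by
      have h1 := h0 x (Finset.mem_univ x)
      rcases div_eq_zero_iff.1 h1 with h2 | h2
      · exact pow_eq_zero_iff (two_ne_zero) |>.1 h2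
      · rw [probLinear_eq_zero hT hs h2]; simp
    simpa [hv] using this

end

/-! ### Vanishing events and the local form of relative entropy -/

section

variable {Ω : Type*} [Fintype Ω] {p q : Ω → ℝ}

lemma sum_le_sum_of_forall_pos {ι : Type*} {A B : Finset ι} {f : ι → ℝ} (hf : ∀ i, 0 ≤ f i)
    (h : ∀ i ∈ A, 0 < f i → i ∈ B) : ∑ i ∈ A, f i ≤ ∑ i ∈ B, f i := by
  classical
  rw [← Finset.sum_filter_of_ne (s := A) (p := fun i => 0 < f i)
    fun i _ h => (hf i).lt_of_ne' h]
  refine Finset.sum_le_sum_of_subset_of_nonneg (fun i hi => ?_) fun i _ _ => hf i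
  exact h i (Finset.mem_filter.1 hi).1 (Finset.mem_filter.1 hi).2

lemma exists_pos_forall_le {p : Ω → ℝ} (hp : ∀ ω, 0 ≤ p ω) :
    ∃ c > 0, ∀ ω, p ω ≠ 0 → c ≤ p ω := by
  have : ∀ᶠ c : ℝ in 𝓝[>] 0, 0 < c ∧ ∀ ω, p ω ≠ 0 → c ≤ p ω := by
    refine eventually_mem_nhdsWithin.and (eventually_all.2 fun ω => ?_)
    by_cases h : p ω = 0
    · simp [h]
    · filter_upwards [eventually_nhdsWithin_of_eventually_nhds
        (eventually_le_nhds ((hp ω).lt_of_ne' h))] with c hc _ using hc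
  exact this.exists

/-- Events excluded by the empirical distribution being near `q` have vanishing probability. -/
lemma tendsto_sum_iid_zero (hq : q ∈ stdSimplex ℝ Ω) (E : (N : ℕ) → Finset (Fin N → Ω)) {κ : ℝ}
    (hκ : 0 < κ) (h : ∀ N > 0, ∀ x : Fin N → Ω, (∀ i, 0 < q (x i)) →
      (∀ ω, |emp x ω - q ω| < κ) → x ∉ E N) :
    Tendsto (fun N => ∑ x ∈ E N, iid q x) atTop (𝓝 0) := by
  classical
  refine squeeze_zero' (Eventually.of_forall fun N => Finset.sum_nonneg fun x _ =>
    iid_nonneg hq.1 x) ?_ (tendsto_sum_iid_not_near hq hκ)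
  filter_upwards [eventually_gt_atTop 0] with N hN
  refine sum_le_sum_of_forall_pos (iid_nonneg hq.1) fun x hx hpos => ?_
  rw [iid_pos_iff hq.1] at hpos
  exact Finset.mem_filter.2 ⟨Finset.mem_univ x, fun hnear => h N hN x hpos hnear hx⟩

lemma tendsto_sum_iid_one_iff (hq : q ∈ stdSimplex ℝ Ω) (A : (N : ℕ) → (Fin N → Ω) → Prop)
    [∀ N, DecidablePred (A N)] :
    Tendsto (fun N => ∑ x with A N x, iid q x) atTop (𝓝 1) ↔
      Tendsto (fun N => ∑ x with ¬ A N x, iid q x) atTop (𝓝 0) := by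
  have h : ∀ N, ∑ x with ¬ A N x, iid q x = 1 - ∑ x with A N x, iid q x := fun N => by
    rw [← sum_iid (N := N) hq, ← Finset.sum_filter_add_sum_filter_not Finset.univ (A N)]
    ring
  constructor <;> intro h1
  · simpa [h] using h1.const_sub 1
  · simpa [h] using h1.const_sub 1

/-- The relative entropy is to leading order half the chi-squared divergence. -/
lemma abs_relEntropy_sub_le (hq : q ∈ stdSimplex ℝ Ω) (hp : p ∈ stdSimplex ℝ Ω) {η : ℝ}
    (hη : η ≤ 1 / 2) (h : ∀ ω, |q ω - p ω| ≤ η * p ω) :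
    |relEntropy q p - (∑ ω, (q ω - p ω) ^ 2 / p ω) / 2| ≤
      4 * η * ∑ ω, (q ω - p ω) ^ 2 / p ω := by
  rw [relEntropy_eq hq hp, Finset.sum_div, ← Finset.sum_sub_distrib, Finset.mul_sum]
  refine (Finset.abs_sum_le_sum_abs _ _).trans (Finset.sum_le_sum fun ω _ => ?_)
  rcases (hp.1 ω).eq_or_lt with h0 | h0
  · have h1 := h ω
    rw [← h0, mul_zero, abs_nonpos_iff, sub_zero] at h1
    simp [← h0, h1]
  set r := (q ω - p ω) / p ω with hr
  have hqr : q ω = p ω * (1 + r) := by rw [hr]; field_simp; ring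
  have hr1 : |r| ≤ η := by
    rw [hr, abs_div, abs_of_pos h0, div_le_iff₀ h0]
    exact h ω
  have e1 : q ω / p ω = 1 + r := by rw [hqr]; field_simp
  have e2 : (q ω - p ω) ^ 2 / p ω = p ω * r ^ 2 := by rw [hr]; field_simp
  rw [e1, e2]
  have e3 : q ω * Real.log (1 + r) - q ω + p ω - p ω * r ^ 2 / 2 =
      p ω * ((1 + r) * Real.log (1 + r) - r - r ^ 2 / 2) := by rw [hqr]; ring
  rw [e3, abs_mul, abs_of_pos h0]
  calc p ω * |(1 + r) * Real.log (1 + r) - r - r ^ 2 / 2| ≤ p ω * (4 * |r| ^ 3) := by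
        gcongr
        exact abs_mul_log_sub_sub_sq_le (hr1.trans hη)
    _ = p ω * (4 * |r| * r ^ 2) := by rw [← sq_abs r]; ring
    _ ≤ p ω * (4 * η * r ^ 2) := by gcongr
    _ = _ := by ring

end

/-! ### The lower bound for consistent estimators -/

section

variable {d : ℕ} {Ω : Type*} [Fintype Ω] {ρ : Param d →ᵃ[ℝ] Op d} {T : Ω → Op d}
  {Δ : Param d → Param d → ℝ} {φ : (N : ℕ) → (Fin N → Ω) → Param d} {s : Param d} {ε c : ℝ}

lemma le_logErrorRate (hε : 0 < ε) {N : ℕ} (hN : 0 < N)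
    (h : Real.exp (-(N * c)) ≤ errorProb ρ T Δ φ s (ε ^ 2) N) :
    ((-c / ε ^ 2 : ℝ) : EReal) ≤ logErrorRate ρ T Δ φ s ε N := by
  have h1 := ENNReal.log_le_log (ENNReal.ofReal_le_ofReal h)
  rw [ENNReal.log_ofReal_of_pos (Real.exp_pos _), Real.log_exp] at h1
  have h2 : (0 : EReal) ≤ ((1 / (ε ^ 2 * (N : ℝ)) : ℝ) : EReal) := by
    exact_mod_cast (by positivity : (0 : ℝ) ≤ 1 / (ε ^ 2 * (N : ℝ)))
  have h3 := mul_le_mul_of_nonneg_left h1 h2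
  refine le_trans (le_of_eq ?_) h3
  rw [← EReal.coe_mul]
  congr 1
  field_simp

lemma logErrorRate_le (hε : 0 < ε) {N : ℕ} (hN : 0 < N)
    (h : errorProb ρ T Δ φ s (ε ^ 2) N ≤ Real.exp (-(N * c))) :
    logErrorRate ρ T Δ φ s ε N ≤ ((-c / ε ^ 2 : ℝ) : EReal) := by
  have h1 := ENNReal.log_le_log (ENNReal.ofReal_le_ofReal h)
  rw [ENNReal.log_ofReal_of_pos (Real.exp_pos _), Real.log_exp] at h1
  have h2 : (0 : EReal) ≤ ((1 / (ε ^ 2 * (N : ℝ)) : ℝ) : EReal) := by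
    exact_mod_cast (by positivity : (0 : ℝ) ≤ 1 / (ε ^ 2 * (N : ℝ)))
  have h3 := mul_le_mul_of_nonneg_left h1 h2
  refine le_trans h3 (le_of_eq ?_)
  rw [← EReal.coe_mul]
  congr 1
  field_simp

lemma tendsto_coe_nhdsWithin {f : ℝ → ℝ} (hf : Continuous f) (a : ℝ) (S : Set ℝ) :
    Tendsto (fun x => ((f x : ℝ) : EReal)) (𝓝[S] a) (𝓝 (f a : EReal)) :=
  ((continuous_coe_real_ereal.comp hf).tendsto a).mono_left nhdsWithin_le_nhds

lemma le_liminf_logErrorRate (hε : 0 < ε)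
    (h : ∀ δ > 0, ∀ᶠ N : ℕ in atTop,
      Real.exp (-(N * (c + δ))) ≤ errorProb ρ T Δ φ s (ε ^ 2) N) :
    ((-c / ε ^ 2 : ℝ) : EReal) ≤ liminf (fun N => logErrorRate ρ T Δ φ s ε N) atTop := by
  have hlim := tendsto_coe_nhdsWithin (f := fun δ => -(c + δ) / ε ^ 2) (by fun_prop) 0
    (Set.Ioi 0)
  rw [add_zero] at hlim
  refine le_of_tendsto hlim (eventually_mem_nhdsWithin.mono fun δ hδ => ?_)
  refine le_liminf_of_le (by isBoundedDefault) ?_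
  filter_upwards [h δ hδ, eventually_gt_atTop 0] with N hN1 hN2 using le_logErrorRate hε hN2 hN1

lemma limsup_logErrorRate_le (hε : 0 < ε)
    (h : ∀ δ > 0, ∀ᶠ N : ℕ in atTop,
      errorProb ρ T Δ φ s (ε ^ 2) N ≤ Real.exp (-(N * (c - δ)))) :
    limsup (fun N => logErrorRate ρ T Δ φ s ε N) atTop ≤ ((-c / ε ^ 2 : ℝ) : EReal) := by
  have hlim := tendsto_coe_nhdsWithin (f := fun δ => -(c - δ) / ε ^ 2) (by fun_prop) 0
    (Set.Ioi 0)
  rw [sub_zero] at hlim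
  refine ge_of_tendsto hlim (eventually_mem_nhdsWithin.mono fun δ hδ => ?_)
  refine limsup_le_of_le (by isBoundedDefault) ?_
  filter_upwards [h δ hδ, eventually_gt_atTop 0] with N hN1 hN2 using logErrorRate_le hε hN2 hN1

open Classical in
lemma errorProb_eq (η : ℝ) (N : ℕ) :
    errorProb ρ T Δ φ s η N = ∑ x : Fin N → Ω with η < Δ (φ N x) s, iid (prob ρ T s) x := rfl

open Classical in
/-- At an alternative state at distance more than `η` from `s`, a consistent estimate is at distance
more than `η` from `s` with probability tending to one. -/
lemma tendsto_sum_iid_error_one (hρ : IsParametrization ρ) (hT : IsPOVM T)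
    (hΔ : IsPseudoDistanceOn Δ (stateSpace ρ))
    (hΔc : ∀ b ∈ stateSpace ρ, ContinuousOn (fun a => Δ a b) (stateSpace ρ))
    (hφ : IsEstimator ρ φ) (hcons : IsConsistent ρ T Δ φ) {t : Param d}
    (hs : s ∈ stateSpace ρ) (ht : t ∈ stateSpace ρ) {η : ℝ} (hη : η < Δ t s) :
    Tendsto (fun N => ∑ x : Fin N → Ω with η < Δ (φ N x) s, iid (prob ρ T t) x)
      atTop (𝓝 1) := by
  have hcomp := isCompact_stateSpace hρ.injective
  -- Compactness replaces the triangle inequality: Δ(·,t) attains its minimum on the compact set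
  -- Δ(·,s) ≤ η, and the minimum is positive because t lies outside that set.
  obtain ⟨η', hη', hsep⟩ : ∃ η' > 0, ∀ a ∈ stateSpace ρ, Δ a s ≤ η → η' < Δ a t := by
    set K := stateSpace ρ ∩ (fun a => Δ a s) ⁻¹' Set.Iic η with hK
    have hKc : IsCompact K := hcomp.of_isClosed_subset
      ((hΔc s hs).preimage_isClosed_of_isClosed hcomp.isClosed isClosed_Iic)
      Set.inter_subset_left
    rcases K.eq_empty_or_nonempty with h | h
    · exact ⟨1, one_pos, fun a ha has => absurd (show a ∈ K from ⟨ha, has⟩) (by simp [h])⟩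
    obtain ⟨a, ha, hmin⟩ := hKc.exists_isMinOn h ((hΔc t ht).mono Set.inter_subset_left)
    have hpos : 0 < Δ a t := (hΔ.nonneg a ha.1 t ht).lt_of_ne' fun h0 => by
      have := ha.2
      rw [hΔ.eq_of_eq_zero a ha.1 t ht h0] at this
      exact absurd hη (not_lt.2 this)
    refine ⟨Δ a t / 2, by positivity, fun b hb hbs => ?_⟩
    have : Δ a t ≤ Δ b t := hmin (show b ∈ K from ⟨hb, hbs⟩)
    linarith
  rw [tendsto_sum_iid_one_iff (prob_mem_stdSimplex hT ht)]
  refine squeeze_zero (fun N => Finset.sum_nonneg fun x _ =>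
    iid_nonneg (prob_mem_stdSimplex hT ht).1 x) (fun N => ?_) (hcons t ht η' hη')
  rw [errorProb_eq]
  refine Finset.sum_le_sum_of_subset_of_nonneg (fun x hx => ?_) fun x _ _ =>
    iid_nonneg (prob_mem_stdSimplex hT ht).1 x
  simp only [Finset.mem_filter, Finset.mem_univ, true_and, not_lt] at hx ⊢
  exact hsep _ (hφ N x) hx

/-- Consistent estimation is possible only if the outcome probabilities separate the states. -/
lemma injOn_prob_of_isConsistent (hρ : IsParametrization ρ) (hT : IsPOVM T)
    (hΔ : IsPseudoDistanceOn Δ (stateSpace ρ))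
    (hΔc : ∀ b ∈ stateSpace ρ, ContinuousOn (fun a => Δ a b) (stateSpace ρ))
    (hφ : IsEstimator ρ φ) (hcons : IsConsistent ρ T Δ φ) :
    Set.InjOn (prob ρ T) (stateSpace ρ) := by
  intro t ht s hs h
  by_contra hne
  have hpos : 0 < Δ t s := (hΔ.nonneg t ht s hs).lt_of_ne' fun h0 =>
    hne (hΔ.eq_of_eq_zero t ht s hs h0)
  -- If t and s had the same law, one and the same event would have probability tending both to 1
  -- and to 0.
  have h1 := tendsto_sum_iid_error_one hρ hT hΔ hΔc hφ hcons hs ht (half_lt_self hpos)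
  rw [h] at h1
  exact one_ne_zero (tendsto_nhds_unique h1 (hcons s hs _ (half_pos hpos)))

omit [Fintype Ω] in
lemma eq_zero_of_probLinear_eq_zero (hinj : Set.InjOn (prob ρ T) (stateSpace ρ))
    (hs : s ∈ interior (stateSpace ρ)) {v : Param d} (hv : ∀ x, probLinear ρ T x v = 0) :
    v = 0 := by
  obtain ⟨c, hc, hc0⟩ := ((eventually_nhdsWithin_of_eventually_nhds (s := Set.Ioi (0 : ℝ))
    ((tendsto_add_smul_nhds s v).eventually (mem_interior_iff_mem_nhds.1 hs))).and
    eventually_mem_nhdsWithin).exists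
  have h := hinj hc (interior_subset hs) (by
    funext x
    rw [prob_add, map_smul, hv x, smul_zero, add_zero])
  exact (smul_eq_zero.1 (add_eq_left.1 h)).resolve_left (ne_of_gt hc0)

/-- Under the alternative `t` the error event is typical by consistency. Changing the measure to `s`
costs the relative entropy. -/
lemma le_liminf_logErrorRate_of_lt (hρ : IsParametrization ρ) (hT : IsPOVM T)
    (hΔ : IsPseudoDistanceOn Δ (stateSpace ρ))
    (hΔc : ∀ b ∈ stateSpace ρ, ContinuousOn (fun a => Δ a b) (stateSpace ρ))
    (hφ : IsEstimator ρ φ) (hcons : IsConsistent ρ T Δ φ) (hs : s ∈ interior (stateSpace ρ))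
    {t : Param d} (ht : t ∈ stateSpace ρ) (hε : 0 < ε) (h : ε ^ 2 < Δ t s) :
    ((-relEntropy (prob ρ T t) (prob ρ T s) / ε ^ 2 : ℝ) : EReal) ≤
      liminf (fun N => logErrorRate ρ T Δ φ s ε N) atTop := by
  refine le_liminf_logErrorRate hε fun δ hδ => ?_
  exact eventually_exp_le_sum_iid (prob_mem_stdSimplex hT ht)
    (prob_mem_stdSimplex hT (interior_subset hs))
    (fun x hx => prob_eq_zero_of_mem_interior hT hs hx t) _
    (tendsto_sum_iid_error_one hρ hT hΔ hΔc hφ hcons (interior_subset hs) ht h) hδ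

lemma eventually_abs_prob_sub_le (hT : IsPOVM T) (hs : s ∈ interior (stateSpace ρ)) {η : ℝ}
    (hη : 0 < η) : ∀ᶠ t in 𝓝 s, ∀ x, |prob ρ T t x - prob ρ T s x| ≤ η * prob ρ T s x := by
  refine eventually_all.2 fun x => ?_
  by_cases h : prob ρ T s x = 0
  · simp [h, prob_eq_zero_of_mem_interior hT hs h]
  · have hpos : 0 < η * prob ρ T s x :=
      mul_pos hη (((prob_mem_stdSimplex hT (interior_subset hs)).1 x).lt_of_ne' h)
    have := (hasFDerivAt_prob (ρ := ρ) (T := T) s x).continuousAt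
    filter_upwards [Metric.tendsto_nhds.1 this _ hpos] with t ht
    rw [Real.dist_eq] at ht
    exact ht.le

/-- Probabilities are affine in the parameter, so the Fisher form is exactly the chi-squared
divergence, with no remainder. -/
lemma sum_sq_prob_sub_div (t : Param d) :
    ∑ x, (prob ρ T t x - prob ρ T s x) ^ 2 / prob ρ T s x =
      (t - s).ofLp ⬝ᵥ (fisher ρ T s).mulVec (t - s).ofLp := by
  rw [dotProduct_fisher_mulVec]
  refine Finset.sum_congr rfl fun x _ => ?_
  rw [prob_eq s t, add_sub_cancel_left]

/-- A direction in which the lower bound on the error exponent is attained. -/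
lemma exists_optimal_direction {H F : Matrix (Fin (d ^ 2 - 1)) (Fin (d ^ 2 - 1)) ℝ}
    (hH : H.PosSemidef) (hH0 : H ≠ 0) (hF : F.PosDef) :
    ∃ u : Param d, u.ofLp ⬝ᵥ H.mulVec u.ofLp = 2 ∧ u.ofLp ⬝ᵥ F.mulVec u.ofLp =
      2 / maxEigenvalue (matrixSqrt H * F⁻¹ * matrixSqrt H) := by
  have hσ := maxEigenvalue_sqrt_mul_inv_mul_sqrt_pos hH hH0 hF
  obtain ⟨w, hw0, hw⟩ := exists_mulVec_eq_maxEigenvalue_smul_mulVec hH hH0 hF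
  set σ := maxEigenvalue (matrixSqrt H * F⁻¹ * matrixSqrt H)
  have hFw : 0 < w ⬝ᵥ F.mulVec w := by simpa using hF.dotProduct_mulVec_pos hw0
  have hHw : w ⬝ᵥ H.mulVec w = σ * (w ⬝ᵥ F.mulVec w) := by
    rw [hw, dotProduct_smul, smul_eq_mul]
  set f := w ⬝ᵥ F.mulVec w
  -- The scaling makes the Hesse form equal to 2, so that a step εu has loss ε² to leading order.
  have hc : √(2 / (σ * f)) ^ 2 = 2 / (σ * f) := Real.sq_sqrt (by positivity)
  refine ⟨√(2 / (σ * f)) • WithLp.toLp 2 w, ?_, ?_⟩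
  · rw [dotProduct_mulVec_smul_smul, hc, hHw]
    field_simp
  · rw [dotProduct_mulVec_smul_smul, hc]
    change 2 / (σ * f) * f = _
    field_simp

/-- The lower bound on the error exponent of a consistent estimator. -/
theorem le_liminf_liminf_logErrorRate (hρ : IsParametrization ρ) (hT : IsPOVM T)
    (hΔ : IsPseudoDistanceOn Δ (stateSpace ρ))
    (hΔc : ∀ b ∈ stateSpace ρ, ContinuousOn (fun a => Δ a b) (stateSpace ρ))
    (hφ : IsEstimator ρ φ) (hcons : IsConsistent ρ T Δ φ) (hs : s ∈ interior (stateSpace ρ))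
    (hf : ContDiffAt ℝ 2 (fun a => Δ a s) s) (hH : hesse Δ s ≠ 0)
    (hF : (fisher ρ T s).PosDef) :
    ((-1 / sigmaOne ρ T Δ s : ℝ) : EReal) ≤
      liminf (fun ε : ℝ => liminf (fun N : ℕ => logErrorRate ρ T Δ φ s ε N) atTop)
        (𝓝[>] 0) := by
  have hHp := posSemidef_hesse hΔ hs hf
  have hσ : 0 < sigmaOne ρ T Δ s := maxEigenvalue_sqrt_mul_inv_mul_sqrt_pos hHp hH hF
  obtain ⟨u, huH, huF⟩ := exists_optimal_direction hHp hH hF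
  change _ = 2 / sigmaOne ρ T Δ s at huF
  set σ := sigmaOne ρ T Δ s
  -- The factor 1 + 8η bounds the entropy by half the chi-squared divergence. The factor (1 + η)²
  -- comes from overshooting the threshold with the step ε(1 + η)u.
  have hlim := tendsto_coe_nhdsWithin (f := fun η => -((1 + 8 * η) * (1 + η) ^ 2) / σ)
    (by fun_prop) 0 (Set.Ioi 0)
  have e0 : -((1 + 8 * (0 : ℝ)) * (1 + 0) ^ 2) = -1 := by norm_num
  rw [e0] at hlim
  refine le_of_tendsto hlim ?_
  filter_upwards [Ioo_mem_nhdsGT (show (0 : ℝ) < 1 / 2 by norm_num)] with η hη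
  obtain ⟨hη0, hη1⟩ := hη
  refine le_liminf_of_le (by isBoundedDefault) ?_
  set c := 1 + η
  have hc1 : 1 < c := by simp only [c]; linarith
  -- A Taylor tolerance small enough for the overshoot c to beat the remainder: c²(1 - η'‖u‖²) > 1.
  set η' := (1 - 1 / c ^ 2) / (‖u‖ ^ 2 + 1)
  have hc2 : 0 < 1 - 1 / c ^ 2 := by
    rw [sub_pos, div_lt_one (by positivity)]
    nlinarith
  have hη' : 0 < η' := by positivity
  have hη'u : 1 < c ^ 2 * (1 - η' * ‖u‖ ^ 2) := by
    have h1 : η' * ‖u‖ ^ 2 < 1 - 1 / c ^ 2 := by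
      simp only [η']
      rw [div_mul_eq_mul_div, div_lt_iff₀ (by positivity)]
      nlinarith
    have h2 : c ^ 2 * (1 / c ^ 2) = 1 := by field_simp
    have h3 : 0 < c ^ 2 := by positivity
    nlinarith
  have hev := (eventually_abs_sub_hesse_le hΔ hs hf hη')
  have h1 := (tendsto_smul_nhds_zero (c • u)).eventually hev
  have h2 := (tendsto_add_smul_nhds s (c • u)).eventually (mem_interior_iff_mem_nhds.1 hs)
  have h3 := (tendsto_add_smul_nhds s (c • u)).eventually
    (eventually_abs_prob_sub_le (ρ := ρ) hT hs hη0)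
  filter_upwards [eventually_nhdsWithin_of_eventually_nhds h1,
    eventually_nhdsWithin_of_eventually_nhds h2, eventually_nhdsWithin_of_eventually_nhds h3,
    eventually_mem_nhdsWithin] with ε hε1 hε2 hε3 hε0
  have hε0 : 0 < ε := hε0
  have hε2 : s + ε • c • u ∈ stateSpace ρ := hε2
  rw [smul_smul] at hε1 hε2 hε3
  have hΔε : ε ^ 2 < Δ (s + (ε * c) • u) s := by
    rw [dotProduct_mulVec_smul_smul, huH, norm_smul, mul_pow ‖ε * c‖, Real.norm_eq_abs,
      sq_abs] at hε1
    have h4 := (abs_le.1 hε1).1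
    have h5 : ε ^ 2 * 1 < ε ^ 2 * (c ^ 2 * (1 - η' * ‖u‖ ^ 2)) := by gcongr
    nlinarith
  refine le_trans ?_ (le_liminf_logErrorRate_of_lt hρ hT hΔ hΔc hφ hcons hs hε2 hε0 hΔε)
  rw [EReal.coe_le_coe_iff]
  have h6 := (abs_le.1 (abs_relEntropy_sub_le (prob_mem_stdSimplex hT hε2)
    (prob_mem_stdSimplex hT (interior_subset hs)) hη1.le hε3)).2
  rw [sum_sq_prob_sub_div, add_sub_cancel_left, dotProduct_mulVec_smul_smul, huF] at h6
  rw [neg_div, neg_div, neg_le_neg_iff, div_le_div_iff₀ (by positivity) hσ]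
  have h7 : relEntropy (prob ρ T (s + (ε * c) • u)) (prob ρ T s) ≤
      (1 + 8 * η) * c ^ 2 * ε ^ 2 / σ := by
    have e : (1 + 8 * η) * c ^ 2 * ε ^ 2 / σ =
      4 * η * ((ε * c) ^ 2 * (2 / σ)) + (ε * c) ^ 2 * (2 / σ) / 2 := by ring
    rw [e]
    linarith
  rwa [le_div_iff₀ hσ] at h7

end

/-! ### Optimality inequalities for weighted likelihoods -/

section

variable {Ω : Type*} [Fintype Ω] {p q Q : Ω → ℝ}

/-- Gibbs' inequality: the likelihood with weights `q` is maximal at `q`. -/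
lemma weightedLikelihood_le_self (hq : q ∈ stdSimplex ℝ Ω) (hp : p ∈ stdSimplex ℝ Ω) :
    weightedLikelihood q p ≤ weightedLikelihood q q := by
  by_cases hac : ∀ ω, p ω = 0 → q ω = 0
  · have h1 : ∀ ω, q ω ≠ 0 → 0 < q ω := fun ω h => (hq.1 ω).lt_of_ne' h
    have h2 : ∀ ω, q ω ≠ 0 → 0 < p ω := fun ω h => (hp.1 ω).lt_of_ne' fun h0 => h (hac ω h0)
    rw [weightedLikelihood_eq_exp h1, weightedLikelihood_eq_exp h2, Real.exp_le_exp,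
      ← sub_nonneg, ← Finset.sum_sub_distrib]
    refine (relEntropy_nonneg hq hp hac).trans_eq (Finset.sum_congr rfl fun ω _ => ?_)
    by_cases h : q ω = 0
    · simp [h]
    · rw [Real.log_div h (h2 ω h).ne', mul_sub]
  · push Not at hac
    obtain ⟨ω, hpω, hqω⟩ := hac
    have : weightedLikelihood q p = 0 :=
      Finset.prod_eq_zero (Finset.mem_univ ω) (by rw [hpω, Real.zero_rpow hqω])
    rw [this]
    exact weightedLikelihood_nonneg hq.1

/-- If `q` satisfies the first order optimality condition for the weights `Q` against `p`, then `p`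
is closer to `q` than to `Q` in the chi-squared sense. -/
lemma sum_sq_sub_div_le_of_sum_mul_div_le_one (hQ : Q ∈ stdSimplex ℝ Ω)
    (hq : q ∈ stdSimplex ℝ Ω) (hp : p ∈ stdSimplex ℝ Ω) (hQq : ∀ ω, q ω = 0 → Q ω = 0)
    (hpq : ∀ ω, q ω = 0 → p ω = 0) (h : ∑ ω, Q ω * (p ω / q ω) ≤ 1) :
    ∑ ω, (q ω - p ω) ^ 2 / q ω ≤ ∑ ω, (Q ω - p ω) ^ 2 / q ω := by
  -- The gap is (Q - q)²/q. Summed, the left side is 2 - 2∑ Q p/q, which is nonnegative by the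
  -- optimality condition.
  have key : ∀ ω, 2 * Q ω - 2 * q ω - 2 * (Q ω * (p ω / q ω)) + 2 * p ω ≤
      (Q ω - p ω) ^ 2 / q ω - (q ω - p ω) ^ 2 / q ω := by
    intro ω
    rcases (hq.1 ω).eq_or_lt with h0 | h0
    · simp [← h0, hQq ω h0.symm, hpq ω h0.symm]
    · have e : (Q ω - p ω) ^ 2 / q ω - (q ω - p ω) ^ 2 / q ω -
          (2 * Q ω - 2 * q ω - 2 * (Q ω * (p ω / q ω)) + 2 * p ω) = (Q ω - q ω) ^ 2 / q ω := by
        field_simp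
        ring
      have : 0 ≤ (Q ω - q ω) ^ 2 / q ω := by positivity
      linarith
  have hs := Finset.sum_le_sum fun ω (_ : ω ∈ Finset.univ) => key ω
  simp only [Finset.sum_sub_distrib, Finset.sum_add_distrib, ← Finset.mul_sum, hQ.2, hq.2,
    hp.2] at hs
  linarith

end

/-! ### The exact exponent of maximum likelihood -/

section

variable {d : ℕ} {Ω : Type*} [Fintype Ω] {ρ : Param d →ᵃ[ℝ] Op d} {T : Ω → Op d}
  {Δ : Param d → Param d → ℝ} {φ : (N : ℕ) → (Fin N → Ω) → Param d} {s : Param d} {ε : ℝ}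

lemma exists_isMLE (hρ : IsParametrization ρ) (hT : IsPOVM T)
    (hne : (stateSpace ρ).Nonempty) :
    ∃ φ : (N : ℕ) → (Fin N → Ω) → Param d, IsMLE ρ T φ := by
  have hM := isAffineModel_prob hρ hT
  have h : ∀ N (x : Fin N → Ω), ∃ t ∈ stateSpace ρ,
      IsMaxOn (fun t => likelihood ρ T t x) (stateSpace ρ) t := fun N x => by
    refine hM.isCompact.exists_isMaxOn hne (continuousOn_finsetProd _ fun i _ => ?_)
    exact (continuous_apply (x i)).comp_continuousOn hM.continuousOn
  choose φ hφ hmax using h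
  exact ⟨φ, hφ, hmax⟩

lemma IsMLE.isMaxOn_weightedLikelihood (hρ : IsParametrization ρ) (hT : IsPOVM T)
    (hφ : IsMLE ρ T φ) {N : ℕ} (hN : 0 < N) (x : Fin N → Ω) :
    IsMaxOn (fun t => weightedLikelihood (emp x) (prob ρ T t)) (stateSpace ρ) (φ N x) :=
  (isAffineModel_prob hρ hT).isMaxOn_weightedLikelihood hN (hφ.1 N x) (hφ.2 N x)

/-- Consistency of maximum likelihood estimators. -/
theorem IsMLE.isConsistent (hρ : IsParametrization ρ) (hT : IsPOVM T)
    (hinj : Set.InjOn (prob ρ T) (stateSpace ρ)) (hΔ : IsPseudoDistanceOn Δ (stateSpace ρ))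
    (hΔc : ∀ b ∈ stateSpace ρ, ContinuousOn (fun a => Δ a b) (stateSpace ρ))
    (hφ : IsMLE ρ T φ) : IsConsistent ρ T Δ φ := by
  intro s hs η hη
  have hM := isAffineModel_prob hρ hT
  have hp := prob_mem_stdSimplex hT hs
  have hW : {a | Δ a s < η} ∈ 𝓝[stateSpace ρ] s := by
    refine (hΔc s hs s hs).eventually (gt_mem_nhds ?_)
    simpa only [hΔ.self_eq_zero s hs] using hη
  obtain ⟨κ, hκ, hstab⟩ := hM.exists_forall_isMaxOn_mem hinj hs hp (fun ω => Iff.rfl)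
    (fun t ht => hM.sum_self_mul_div_le_one ht) hW
  refine tendsto_sum_iid_zero hp _ hκ fun N hN x hpos hnear hx => ?_
  have h1 := hstab (emp x) (emp_mem_stdSimplex hN x) hnear
    (fun ω hω => emp_eq_zero_of_pos hpos hω) (φ N x) (hφ.1 N x)
    (hφ.isMaxOn_weightedLikelihood hρ hT hN x)
  exact lt_asymm h1 (Finset.mem_filter.1 hx).2

/-- The empirical distributions of full support with a maximum likelihood estimate in error by more
than `η`. -/
def errorTypes (ρ : Param d →ᵃ[ℝ] Op d) (T : Ω → Op d) (Δ : Param d → Param d → ℝ)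
    (s : Param d) (η : ℝ) : Set (Ω → ℝ) :=
  {Q | Q ∈ stdSimplex ℝ Ω ∧ (∀ ω, Q ω = 0 ↔ prob ρ T s ω = 0) ∧ ∃ t ∈ stateSpace ρ,
    IsMaxOn (fun t => weightedLikelihood Q (prob ρ T t)) (stateSpace ρ) t ∧ η < Δ t s}

/-- The error exponent of maximum likelihood estimation. -/
def errorExponent (ρ : Param d →ᵃ[ℝ] Op d) (T : Ω → Op d) (Δ : Param d → Param d → ℝ)
    (s : Param d) (η : ℝ) : ℝ :=
  sInf ((fun Q => relEntropy Q (prob ρ T s)) '' errorTypes ρ T Δ s η)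

lemma relEntropy_nonneg_of_mem_errorTypes (hT : IsPOVM T) (hs : s ∈ stateSpace ρ) {η : ℝ}
    {Q : Ω → ℝ} (hQ : Q ∈ errorTypes ρ T Δ s η) : 0 ≤ relEntropy Q (prob ρ T s) :=
  relEntropy_nonneg hQ.1 (prob_mem_stdSimplex hT hs) fun ω => (hQ.2.1 ω).2

lemma errorExponent_le (hT : IsPOVM T) (hs : s ∈ stateSpace ρ) {η : ℝ}
    {Q : Ω → ℝ} (hQ : Q ∈ errorTypes ρ T Δ s η) :
    errorExponent ρ T Δ s η ≤ relEntropy Q (prob ρ T s) := by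
  refine csInf_le ⟨0, ?_⟩ ⟨Q, hQ, rfl⟩
  rintro _ ⟨Q', hQ', rfl⟩
  exact relEntropy_nonneg_of_mem_errorTypes hT hs hQ'

lemma pos_prob_of_isMaxOn (hρ : IsParametrization ρ) (hT : IsPOVM T) (hs : s ∈ stateSpace ρ)
    {t : Param d} (ht : t ∈ stateSpace ρ) {Q : Ω → ℝ}
    (hsupp : ∀ ω, prob ρ T s ω = 0 → Q ω = 0)
    (hmax : IsMaxOn (fun t => weightedLikelihood Q (prob ρ T t)) (stateSpace ρ) t) {ω : Ω}
    (hω : Q ω ≠ 0) : 0 < prob ρ T t ω :=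
  (isAffineModel_prob hρ hT).pos_of_isMaxOn ht hs (fun ω h h0 => h (hsupp ω h0)) hmax hω

/-- Under sampling from Q the type is close to Q. Stability then puts every maximizer near t, so the
estimator errs with probability tending to one whichever maximizer it selects. -/
lemma eventually_exp_le_errorProb (hρ : IsParametrization ρ) (hT : IsPOVM T)
    (hinj : Set.InjOn (prob ρ T) (stateSpace ρ))
    (hΔc : ∀ b ∈ stateSpace ρ, ContinuousOn (fun a => Δ a b) (stateSpace ρ))
    (hφ : IsMLE ρ T φ) (hs : s ∈ interior (stateSpace ρ)) {η : ℝ} {Q : Ω → ℝ}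
    (hQ : Q ∈ errorTypes ρ T Δ s η) {δ : ℝ} (hδ : 0 < δ) :
    ∀ᶠ N : ℕ in atTop, Real.exp (-(N * (relEntropy Q (prob ρ T s) + δ))) ≤
      errorProb ρ T Δ φ s η N := by
  classical
  obtain ⟨hQ1, hQ2, t, ht, hmax, htη⟩ := hQ
  have hsS := interior_subset hs
  have hM := isAffineModel_prob hρ hT
  have hpos : ∀ ω, Q ω ≠ 0 → 0 < prob ρ T t ω := fun ω =>
    pos_prob_of_isMaxOn hρ hT hsS ht (fun ω => (hQ2 ω).2) hmax
  have hsupp : ∀ ω, Q ω = 0 ↔ prob ρ T t ω = 0 := fun ω =>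
    ⟨fun h => prob_eq_zero_of_mem_interior hT hs ((hQ2 ω).1 h) t,
      fun h => by_contra fun h0 => (hpos ω h0).ne' h⟩
  have hW : {a | η < Δ a s} ∈ 𝓝[stateSpace ρ] t :=
    (hΔc s hsS t ht).eventually (lt_mem_nhds htη)
  obtain ⟨κ, hκ, hstab⟩ := hM.exists_forall_isMaxOn_mem hinj ht hQ1 hsupp
    (fun u hu => hM.sum_mul_div_le_one hQ1 ht hu hpos hmax) hW
  refine eventually_exp_le_sum_iid hQ1 (prob_mem_stdSimplex hT hsS) (fun ω => (hQ2 ω).2) _ ?_ hδ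
  rw [tendsto_sum_iid_one_iff hQ1]
  refine tendsto_sum_iid_zero hQ1 _ hκ fun N hN x hx hnear hmem => ?_
  refine (Finset.mem_filter.1 hmem).2 ?_
  exact hstab (emp x) (emp_mem_stdSimplex hN x) hnear
    (fun ω hω => emp_eq_zero_of_pos hx ((hsupp ω).2 hω)) (φ N x) (hφ.1 N x)
    (hφ.isMaxOn_weightedLikelihood hρ hT hN x)

/-- The error probability of maximum likelihood estimation decays exponentially in the number of
trials. -/
lemma tendsto_logErrorRate (hρ : IsParametrization ρ) (hT : IsPOVM T)
    (hinj : Set.InjOn (prob ρ T) (stateSpace ρ))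
    (hΔc : ∀ b ∈ stateSpace ρ, ContinuousOn (fun a => Δ a b) (stateSpace ρ))
    (hφ : IsMLE ρ T φ) (hs : s ∈ interior (stateSpace ρ)) (hε : 0 < ε)
    (hne : (errorTypes ρ T Δ s (ε ^ 2)).Nonempty)
    (hle : ∀ ω, prob ρ T s ω ≠ 0 → errorExponent ρ T Δ s (ε ^ 2) ≤ prob ρ T s ω ^ 2 / 4) :
    Tendsto (fun N : ℕ => logErrorRate ρ T Δ φ s ε N) atTop
      (𝓝 ((-errorExponent ρ T Δ s (ε ^ 2) / ε ^ 2 : ℝ) : EReal)) := by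
  classical
  have hsS := interior_subset hs
  have hp := prob_mem_stdSimplex hT hsS
  refine tendsto_of_le_liminf_of_limsup_le (le_liminf_logErrorRate hε fun δ hδ => ?_)
    (limsup_logErrorRate_le hε fun δ hδ => ?_) (by isBoundedDefault) (by isBoundedDefault)
  · obtain ⟨_, ⟨Q, hQ, rfl⟩, hlt⟩ := exists_lt_of_csInf_lt (hne.image _)
      (lt_add_of_pos_right (errorExponent ρ T Δ s (ε ^ 2)) (half_pos hδ))
    simp only at hlt
    filter_upwards [eventually_exp_le_errorProb hρ hT hinj hΔc hφ hs hQ (half_pos hδ)] with N hN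
    refine le_trans (Real.exp_le_exp.2 (neg_le_neg
      (mul_le_mul_of_nonneg_left ?_ N.cast_nonneg))) hN
    linarith
  · have h1 := tendsto_types_bound (Fintype.card Ω) hδ
    filter_upwards [h1.eventually (gt_mem_nhds one_pos), eventually_gt_atTop 0] with N hN1 hN
    have h2 : errorProb ρ T Δ φ s (ε ^ 2) N ≤ ((N : ℝ) + 1) ^ Fintype.card Ω *
        Real.exp (-(N * errorExponent ρ T Δ s (ε ^ 2))) := by
      refine sum_iid_le_of_le_relEntropy hp hN _ fun x hx hpos => ?_
      have hac : ∀ ω, prob ρ T s ω = 0 → emp x ω = 0 := fun ω h => emp_eq_zero_of_pos hpos h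
      have hemp := emp_mem_stdSimplex hN x
      by_cases hsupp : ∀ ω, emp x ω = 0 → prob ρ T s ω = 0
      · refine errorExponent_le hT hsS ⟨hemp, fun ω => ⟨hsupp ω, hac ω⟩, φ N x, hφ.1 N x,
          hφ.isMaxOn_weightedLikelihood hρ hT hN x, (Finset.mem_filter.1 hx).2⟩
      -- A type missing a possible outcome ω costs at least p(ω)²/4, which `hle` puts above the
      -- exponent.
      · push Not at hsupp
        obtain ⟨ω, hω, hpω⟩ := hsupp
        refine (hle ω hpω).trans ?_
        have := sq_sub_le_relEntropy hemp hp hac ω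
        rwa [hω, zero_sub, neg_sq] at this
    calc _ ≤ _ := h2
      _ = ((N : ℝ) + 1) ^ Fintype.card Ω * Real.exp (-(N * δ)) *
          Real.exp (-(N * (errorExponent ρ T Δ s (ε ^ 2) - δ))) := by
        rw [mul_assoc, ← Real.exp_add]
        congr 2
        ring
      _ ≤ _ := mul_le_of_le_one_left (Real.exp_pos _).le hN1.le

/-- Nearby states give error types of small relative entropy. -/
lemma exists_mem_errorTypes_relEntropy_le (hρ : IsParametrization ρ) (hT : IsPOVM T)
    (hΔ : IsPseudoDistanceOn Δ (stateSpace ρ)) (hs : s ∈ interior (stateSpace ρ))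
    [Nontrivial (Param d)] {c : ℝ} (hc : 0 < c) :
    ∃ Q, relEntropy Q (prob ρ T s) ≤ c ∧ ∃ η₀ > 0, ∀ η < η₀, Q ∈ errorTypes ρ T Δ s η := by
  have hsS := interior_subset hs
  have hM := isAffineModel_prob hρ hT
  have hp := prob_mem_stdSimplex hT hsS
  -- The relative entropy is then at most (1/2 + 4η)η² ≤ c.
  set η := min (1 / 4) c
  have hη : 0 < η := by positivity
  have hη4 : η ≤ 1 / 4 := min_le_left _ _
  have hηc : η ≤ c := min_le_right _ _
  obtain ⟨u, hu⟩ := exists_ne (0 : Param d)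
  obtain ⟨a, ⟨ha1, ha2⟩, ha0⟩ := ((eventually_nhdsWithin_of_eventually_nhds (s := Set.Ioi (0 : ℝ))
    ((tendsto_add_smul_nhds s u).eventually ((eventually_mem_set.2 (mem_interior_iff_mem_nhds.1 hs)).and
      (eventually_abs_prob_sub_le (ρ := ρ) hT hs hη)))).and eventually_mem_nhdsWithin).exists
  set t := s + a • u with ht
  have htS : t ∈ stateSpace ρ := ha1
  have hts : t ≠ s := fun h => by
    rw [ht, add_eq_left, smul_eq_zero] at h
    exact h.elim (ne_of_gt ha0) hu
  have hq := prob_mem_stdSimplex hT htS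
  have hχ : ∑ ω, (prob ρ T t ω - prob ρ T s ω) ^ 2 / prob ρ T s ω ≤ η ^ 2 := by
    calc _ ≤ ∑ ω, η ^ 2 * prob ρ T s ω := by
          refine Finset.sum_le_sum fun ω _ => ?_
          rcases (hp.1 ω).eq_or_lt with h0 | h0
          · simp [← h0]
          · rw [div_le_iff₀ h0, ← sq_abs]
            calc _ ≤ (η * prob ρ T s ω) ^ 2 := by gcongr; exact ha2 ω
              _ = _ := by ring
      _ = η ^ 2 := by rw [← Finset.mul_sum, hp.2, mul_one]
  refine ⟨prob ρ T t, ?_, Δ t s, (hΔ.nonneg t htS s hsS).lt_of_ne' fun h0 =>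
    hts (hΔ.eq_of_eq_zero t htS s hsS h0), fun η' hη' => ⟨hq, fun ω => ⟨fun h => ?_, fun h =>
      prob_eq_zero_of_mem_interior hT hs h t⟩, t, htS, fun u hu =>
      weightedLikelihood_le_self hq (prob_mem_stdSimplex hT hu), hη'⟩⟩
  · have h1 := (abs_le.1 (abs_relEntropy_sub_le hq hp (by linarith) ha2)).2
    set χ := ∑ ω, (prob ρ T t ω - prob ρ T s ω) ^ 2 / prob ρ T s ω
    nlinarith
  · have h1 := ha2 ω
    rw [h, zero_sub, abs_neg, abs_of_nonneg (hp.1 ω)] at h1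
    nlinarith [hp.1 ω]

/-- Injectivity of the model makes the linear map v ↦ (`probLinear ρ T x v`)ₓ bounded below, and
division by probabilities at most 1 only enlarges the squares. -/
lemma exists_norm_sq_le_mul_fisher (hT : IsPOVM T) (hs : s ∈ interior (stateSpace ρ))
    (hinj : Set.InjOn (prob ρ T) (stateSpace ρ)) :
    ∃ C > 0, ∀ v : Param d, ‖v‖ ^ 2 ≤ C * (v.ofLp ⬝ᵥ (fisher ρ T s).mulVec v.ofLp) := by
  have hp := prob_mem_stdSimplex hT (interior_subset hs)
  let L : Param d →ₗ[ℝ] (Ω → ℝ) := LinearMap.pi fun x => (probLinear ρ T x).toLinearMap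
  have hker : LinearMap.ker L = ⊥ := by
    refine LinearMap.ker_eq_bot'.2 fun v hv => ?_
    exact eq_zero_of_probLinear_eq_zero hinj hs fun x => congrFun hv x
  obtain ⟨K, hK0, hK⟩ := L.exists_antilipschitzWith hker
  have hK0' : (0 : ℝ) < K := hK0
  refine ⟨K ^ 2, by positivity, fun v => ?_⟩
  rw [dotProduct_fisher_mulVec]
  set f := ∑ x, probLinear ρ T x v ^ 2 / prob ρ T s x
  have hf : 0 ≤ f := Finset.sum_nonneg fun x _ => div_nonneg (sq_nonneg _) (hp.1 x)
  have h1 : ‖v‖ ≤ K * ‖L v‖ := by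
    simpa using hK.le_mul_dist v 0
  have h2 : ‖L v‖ ≤ √f := by
    refine (pi_norm_le_iff_of_nonneg (Real.sqrt_nonneg _)).2 fun x => Real.abs_le_sqrt ?_
    change probLinear ρ T x v ^ 2 ≤ f
    by_cases h0 : prob ρ T s x = 0
    · rw [probLinear_eq_zero hT hs h0]
      simpa using hf
    · refine le_trans ?_ (Finset.single_le_sum
        (f := fun x => probLinear ρ T x v ^ 2 / prob ρ T s x)
        (fun x _ => div_nonneg (sq_nonneg _) (hp.1 x)) (Finset.mem_univ x))
      rw [le_div_iff₀ ((hp.1 x).lt_of_ne' h0)]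
      exact mul_le_of_le_one_right (sq_nonneg _) (le_one_of_mem_stdSimplex hp x)
  calc ‖v‖ ^ 2 ≤ (K * √f) ^ 2 := by gcongr; exact h1.trans (by gcongr)
    _ = K ^ 2 * f := by rw [mul_pow, Real.sq_sqrt hf]

/-- Near `s` the pseudo-distance is controlled by the Fisher information. -/
lemma eventually_le_mul_fisher (hT : IsPOVM T) (hΔ : IsPseudoDistanceOn Δ (stateSpace ρ))
    (hs : s ∈ interior (stateSpace ρ)) (hinj : Set.InjOn (prob ρ T) (stateSpace ρ))
    (hf : ContDiffAt ℝ 2 (fun a => Δ a s) s) (hH : hesse Δ s ≠ 0)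
    (hF : (fisher ρ T s).PosDef) {η : ℝ} (hη : 0 < η) :
    ∀ᶠ t in 𝓝 s, Δ t s ≤ (1 + η) * (sigmaOne ρ T Δ s / 2 *
      ((t - s).ofLp ⬝ᵥ (fisher ρ T s).mulVec (t - s).ofLp)) := by
  have hHp := posSemidef_hesse hΔ hs hf
  have hσ : 0 < sigmaOne ρ T Δ s := maxEigenvalue_sqrt_mul_inv_mul_sqrt_pos hHp hH hF
  obtain ⟨C, hC, hnorm⟩ := exists_norm_sq_le_mul_fisher hT hs hinj
  have hsub : Tendsto (fun t => t - s) (𝓝 s) (𝓝 0) := by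
    have : ContinuousAt (fun t => t - s) s := by fun_prop
    simpa [ContinuousAt] using this
  filter_upwards [hsub.eventually (eventually_abs_sub_hesse_le hΔ hs hf
    (show 0 < η * (sigmaOne ρ T Δ s / 2) / C by positivity))] with t ht
  rw [add_sub_cancel] at ht
  have h1 := (abs_le.1 ht).2
  have h2 := dotProduct_mulVec_le_maxEigenvalue_mul hHp hH hF (t - s).ofLp
  change _ ≤ sigmaOne ρ T Δ s * _ at h2
  have h3 := mul_le_mul_of_nonneg_left (hnorm (t - s))
    (show 0 ≤ η * (sigmaOne ρ T Δ s / 2) / C by positivity)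
  set f := (t - s).ofLp ⬝ᵥ (fisher ρ T s).mulVec (t - s).ofLp
  have e : η * (sigmaOne ρ T Δ s / 2) / C * (C * f) = η * (sigmaOne ρ T Δ s / 2) * f := by
    field_simp
  rw [e] at h3
  linarith

/-- The lower bound on the relative entropy of error types. -/
lemma eventually_le_relEntropy_of_mem_errorTypes (hρ : IsParametrization ρ) (hT : IsPOVM T)
    (hΔ : IsPseudoDistanceOn Δ (stateSpace ρ)) (hs : s ∈ interior (stateSpace ρ))
    (hinj : Set.InjOn (prob ρ T) (stateSpace ρ))
    (hf : ContDiffAt ℝ 2 (fun a => Δ a s) s) (hH : hesse Δ s ≠ 0)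
    (hF : (fisher ρ T s).PosDef) {η : ℝ} (hη : 0 < η) (hη8 : η < 1 / 8) :
    ∀ᶠ ε in 𝓝[>] (0 : ℝ), ∀ Q ∈ errorTypes ρ T Δ s (ε ^ 2),
      (1 - 8 * η) * (1 - η) / (1 + η) ^ 2 / sigmaOne ρ T Δ s * ε ^ 2 ≤
        relEntropy Q (prob ρ T s) := by
  have hHp := posSemidef_hesse hΔ hs hf
  have hσ : 0 < sigmaOne ρ T Δ s := maxEigenvalue_sqrt_mul_inv_mul_sqrt_pos hHp hH hF
  have hsS := interior_subset hs
  have hM := isAffineModel_prob hρ hT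
  have hp := prob_mem_stdSimplex hT hsS
  have hW := eventually_nhdsWithin_of_eventually_nhds (s := stateSpace ρ)
    ((eventually_abs_prob_sub_le (ρ := ρ) hT hs hη).and
      (eventually_le_mul_fisher hT hΔ hs hinj hf hH hF hη))
  obtain ⟨κ, hκ, hstab⟩ := hM.exists_forall_isMaxOn_mem hinj hsS hp (fun ω => Iff.rfl)
    (fun t ht => hM.sum_self_mul_div_le_one ht) hW
  obtain ⟨m, hm, hmp⟩ := exists_pos_forall_le hp.1
  -- The first bound localizes the maximizer. The second turns closeness into the relative bound |Q
  -- - p| ≤ ηp.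
  set κ' := min κ (η * m)
  have hκ' : 0 < κ' := by positivity
  set σ := sigmaOne ρ T Δ s
  set b := (1 - 8 * η) * (1 - η) / (1 + η) ^ 2 / σ with hb
  -- Types not within κ' of p_s have relative entropy at least κ'²/4, so for small ε they satisfy
  -- the claim.
  have hsmall : ∀ᶠ ε in 𝓝[>] (0 : ℝ), b * ε ^ 2 < κ' ^ 2 / 4 := by
    refine eventually_nhdsWithin_of_eventually_nhds ?_
    have : ContinuousAt (fun ε : ℝ => b * ε ^ 2) 0 := by fun_prop
    refine this.eventually (gt_mem_nhds ?_)
    simp only [ne_eq, OfNat.ofNat_ne_zero, not_false_eq_true, zero_pow, mul_zero]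
    positivity
  filter_upwards [hsmall] with ε hε Q ⟨hQ, hsupp, t, ht, hmax, htε⟩
  have hac : ∀ ω, prob ρ T s ω = 0 → Q ω = 0 := fun ω => (hsupp ω).2
  by_cases hnear : ∀ ω, |Q ω - prob ρ T s ω| < κ'
  · obtain ⟨hpt, hΔt⟩ := hstab Q hQ (fun ω => (hnear ω).trans_le (min_le_left _ _)) hac t ht hmax
    have hq := prob_mem_stdSimplex hT ht
    have hQη : ∀ ω, |Q ω - prob ρ T s ω| ≤ η * prob ρ T s ω := by
      intro ω
      by_cases h0 : prob ρ T s ω = 0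
      · simp [h0, hac ω h0]
      · refine (hnear ω).le.trans ((min_le_right _ _).trans ?_)
        gcongr
        exact hmp ω h0
    have h1 := (abs_le.1 (abs_relEntropy_sub_le hQ hp (by linarith) hQη)).1
    have hpos : ∀ ω, Q ω ≠ 0 → 0 < prob ρ T t ω := fun ω =>
      pos_prob_of_isMaxOn hρ hT hsS ht hac hmax
    have hQ0 : ∀ ω, prob ρ T t ω = 0 → Q ω = 0 := fun ω h =>
      by_contra fun h0 => (hpos ω h0).ne' h
    have h2 := sum_sq_sub_div_le_of_sum_mul_div_le_one hQ hq hp hQ0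
      (fun ω h => (hsupp ω).1 (hQ0 ω h)) (hM.sum_mul_div_le_one hQ ht hsS hpos hmax)
    -- The chi-squared comparison has denominators p_t, while entropy and Fisher form have p_s; each
    -- exchange costs a factor 1 ± η.
    have h3 : (1 - η) * ∑ ω, (Q ω - prob ρ T s ω) ^ 2 / prob ρ T t ω ≤
        ∑ ω, (Q ω - prob ρ T s ω) ^ 2 / prob ρ T s ω := by
      rw [Finset.mul_sum]
      refine Finset.sum_le_sum fun ω _ => ?_
      rcases (hp.1 ω).eq_or_lt with h0 | h0
      · simp [hac ω h0.symm, ← h0]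
      · have hqω := hpos ω fun h => h0.ne' ((hsupp ω).1 h)
        rw [← mul_div_assoc, div_le_div_iff₀ hqω h0]
        have := (abs_le.1 (hpt ω)).1
        nlinarith [sq_nonneg (Q ω - prob ρ T s ω)]
    have h4 : ∑ ω, (prob ρ T t ω - prob ρ T s ω) ^ 2 / prob ρ T s ω ≤
        (1 + η) * ∑ ω, (prob ρ T t ω - prob ρ T s ω) ^ 2 / prob ρ T t ω := by
      rw [Finset.mul_sum]
      refine Finset.sum_le_sum fun ω _ => ?_
      rcases (hp.1 ω).eq_or_lt with h0 | h0
      · rw [← h0, prob_eq_zero_of_mem_interior hT hs h0.symm t]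
        simp
      · have hqω := hpos ω fun h => h0.ne' ((hsupp ω).1 h)
        rw [← mul_div_assoc, div_le_div_iff₀ h0 hqω]
        have := (abs_le.1 (hpt ω)).2
        nlinarith [sq_nonneg (prob ρ T t ω - prob ρ T s ω)]
    rw [sum_sq_prob_sub_div] at h4
    have hΔt : Δ t s ≤ (1 + η) * (σ / 2 *
      ((t - s).ofLp ⬝ᵥ (fisher ρ T s).mulVec (t - s).ofLp)) := hΔt
    set f := (t - s).ofLp ⬝ᵥ (fisher ρ T s).mulVec (t - s).ofLp
    set A := ∑ ω, (prob ρ T t ω - prob ρ T s ω) ^ 2 / prob ρ T t ω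
    set B := ∑ ω, (Q ω - prob ρ T s ω) ^ 2 / prob ρ T t ω
    set X := ∑ ω, (Q ω - prob ρ T s ω) ^ 2 / prob ρ T s ω
    have h5 : (1 - η) * A ≤ X := (mul_le_mul_of_nonneg_left h2 (by linarith)).trans h3
    have h6 : 2 * ε ^ 2 ≤ (1 + η) ^ 2 * σ * A := by
      have : (1 + η) * (σ / 2 * f) ≤ (1 + η) * (σ / 2 * ((1 + η) * A)) := by gcongr
      nlinarith
    have h7 : (1 - 8 * η) / 2 * X ≤ relEntropy Q (prob ρ T s) := by linarith
    refine le_trans ?_ h7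
    calc b * ε ^ 2 = (1 - 8 * η) / 2 * ((1 - η) * (2 * ε ^ 2 / ((1 + η) ^ 2 * σ))) := by
          rw [hb]; field_simp
      _ ≤ (1 - 8 * η) / 2 * ((1 - η) * A) := by
          have h8 : 0 ≤ (1 - 8 * η) / 2 := by linarith
          have h9 : 0 ≤ 1 - η := by linarith
          gcongr
          rw [div_le_iff₀ (by positivity)]
          linarith
      _ ≤ (1 - 8 * η) / 2 * X := by
          have h8 : 0 ≤ (1 - 8 * η) / 2 := by linarith
          gcongr
  · push Not at hnear
    obtain ⟨ω, hω⟩ := hnear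
    refine hε.le.trans (le_trans ?_ (sq_sub_le_relEntropy hQ hp hac ω))
    rw [← sq_abs (Q ω - prob ρ T s ω)]
    gcongr

/-- The exact error exponent of maximum likelihood estimation. -/
theorem IsMLE.exists_tendsto_logErrorRate (hρ : IsParametrization ρ) (hT : IsPOVM T)
    (hinj : Set.InjOn (prob ρ T) (stateSpace ρ))
    (hΔ : IsPseudoDistanceOn Δ (stateSpace ρ))
    (hΔc : ∀ b ∈ stateSpace ρ, ContinuousOn (fun a => Δ a b) (stateSpace ρ))
    (hφ : IsMLE ρ T φ) (hs : s ∈ interior (stateSpace ρ))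
    (hf : ContDiffAt ℝ 2 (fun a => Δ a s) s) (hH : hesse Δ s ≠ 0)
    (hF : (fisher ρ T s).PosDef) :
    ∃ L : ℝ → EReal,
      (∀ᶠ ε in 𝓝[>] (0 : ℝ),
        Tendsto (fun N : ℕ => logErrorRate ρ T Δ φ s ε N) atTop (𝓝 (L ε))) ∧
      Tendsto L (𝓝[>] 0) (𝓝 ((-1 / sigmaOne ρ T Δ s : ℝ) : EReal)) := by
  have hsS := interior_subset hs
  have hp := prob_mem_stdSimplex hT hsS
  have hnt : Nontrivial (Param d) := by
    by_contra h
    rw [not_nontrivial_iff_subsingleton] at h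
    refine hH (Matrix.ext fun α => ?_)
    have := Subsingleton.elim (EuclideanSpace.single α (1 : ℝ) : Param d) 0
    simp at this
  obtain ⟨m, hm, hmp⟩ := exists_pos_forall_le hp.1
  -- One error type of entropy at most m²/4 keeps the exponent, for all small ε, below the cost of
  -- types with a missing outcome.
  obtain ⟨Q, hQm, η₀, hη₀, hQ⟩ := exists_mem_errorTypes_relEntropy_le hρ hT hΔ hs
    (show 0 < m ^ 2 / 4 by positivity)
  have hQε : ∀ᶠ ε in 𝓝[>] (0 : ℝ), Q ∈ errorTypes ρ T Δ s (ε ^ 2) := by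
    refine eventually_nhdsWithin_of_eventually_nhds ?_
    have : ContinuousAt (fun ε : ℝ => ε ^ 2) 0 := by fun_prop
    exact (this.eventually (gt_mem_nhds (by simpa using hη₀))).mono fun ε hε => hQ _ hε
  have hlim : ∀ᶠ ε in 𝓝[>] (0 : ℝ),
      Tendsto (fun N : ℕ => logErrorRate ρ T Δ φ s ε N) atTop
        (𝓝 ((-errorExponent ρ T Δ s (ε ^ 2) / ε ^ 2 : ℝ) : EReal)) := by
    filter_upwards [hQε, eventually_mem_nhdsWithin] with ε hε hε0
    refine tendsto_logErrorRate hρ hT hinj hΔc hφ hs hε0 ⟨Q, hε⟩ fun ω hω => ?_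
    refine (errorExponent_le hT hsS hε).trans (hQm.trans ?_)
    gcongr
    exact hmp ω hω
  refine ⟨_, hlim, tendsto_of_le_liminf_of_limsup_le ?_ ?_ (by isBoundedDefault)
    (by isBoundedDefault)⟩
  · refine (le_liminf_liminf_logErrorRate hρ hT hΔ hΔc hφ.1
      (hφ.isConsistent hρ hT hinj hΔ hΔc) hs hf hH hF).trans_eq ?_
    exact liminf_congr (hlim.mono fun ε hε => hε.liminf_eq)
  · set σ := sigmaOne ρ T Δ s
    have hcont : Tendsto (fun η : ℝ =>
        ((-((1 - 8 * η) * (1 - η) / (1 + η) ^ 2 / σ) : ℝ) : EReal)) (𝓝[>] 0)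
        (𝓝 ((-1 / σ : ℝ) : EReal)) := by
      have h1 : ContinuousAt (fun η : ℝ => -((1 - 8 * η) * (1 - η) / (1 + η) ^ 2 / σ)) 0 := by
        refine ContinuousAt.neg (ContinuousAt.div_const (ContinuousAt.div (by fun_prop)
          (by fun_prop) (by norm_num)) _)
      have h2 := (continuous_coe_real_ereal.continuousAt.comp h1).tendsto
      have e : -((1 - 8 * (0 : ℝ)) * (1 - 0) / (1 + 0) ^ 2 / σ) = -1 / σ := by norm_num [neg_div]
      simp only [Function.comp_def, e] at h2
      exact h2.mono_left nhdsWithin_le_nhds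
    refine ge_of_tendsto hcont ?_
    filter_upwards [Ioo_mem_nhdsGT (show (0 : ℝ) < 1 / 8 by norm_num)] with η hη
    refine limsup_le_of_le (by isBoundedDefault) ?_
    filter_upwards [hQε, eventually_mem_nhdsWithin,
      eventually_le_relEntropy_of_mem_errorTypes hρ hT hΔ hs hinj hf hH hF hη.1 hη.2]
      with ε hε hε0 hle
    have hε0 : 0 < ε := hε0
    rw [EReal.coe_le_coe_iff, neg_div, neg_le_neg_iff, le_div_iff₀ (by positivity)]
    refine le_csInf (Set.Nonempty.image _ ⟨Q, hε⟩) ?_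
    rintro _ ⟨Q', hQ', rfl⟩
    exact hle Q' hQ'

end

end

end QTomography

/-! ### The main theorem -/

theorem theorem1 {d : ℕ} {Ω : Type*} [Fintype Ω]
    (ρ : QTomography.Param d →ᵃ[ℝ] QTomography.Op d) (hρ : QTomography.IsParametrization ρ)
    (T : Ω → QTomography.Op d) (hT : QTomography.IsPOVM T)
    (Δ : QTomography.Param d → QTomography.Param d → ℝ)
    (hΔ : QTomography.IsPseudoDistanceOn Δ (QTomography.stateSpace ρ))
    (hΔ_cont : ∀ b ∈ QTomography.stateSpace ρ,
      ContinuousOn (fun a => Δ a b) (QTomography.stateSpace ρ))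
    (s : QTomography.Param d) (hs : s ∈ interior (QTomography.stateSpace ρ))
    (hΔ_smooth : ContDiffAt ℝ 2 (fun a => Δ a s) s)
    (hH : QTomography.hesse Δ s ≠ 0) :
    (QTomography.hesse Δ s).PosSemidef ∧
    (∀ φ : (N : ℕ) → (Fin N → Ω) → QTomography.Param d,
      QTomography.IsEstimator ρ φ → QTomography.IsConsistent ρ T Δ φ →
        IsUnit (QTomography.fisher ρ T s).det ∧
        0 < QTomography.sigmaOne ρ T Δ s ∧
        ((-1 / QTomography.sigmaOne ρ T Δ s : ℝ) : EReal) ≤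
          liminf (fun ε : ℝ =>
            liminf (fun N : ℕ => QTomography.logErrorRate ρ T Δ φ s ε N) atTop) (𝓝[>] 0)) ∧
    (QTomography.InformationallyComplete T →
      (∃ φ : (N : ℕ) → (Fin N → Ω) → QTomography.Param d, QTomography.IsMLE ρ T φ) ∧
      ∀ φ : (N : ℕ) → (Fin N → Ω) → QTomography.Param d, QTomography.IsMLE ρ T φ →
        QTomography.IsConsistent ρ T Δ φ ∧
        ∃ L : ℝ → EReal,
          (∀ᶠ ε in 𝓝[>] (0 : ℝ),
            Tendsto (fun N : ℕ => QTomography.logErrorRate ρ T Δ φ s ε N) atTop (𝓝 (L ε))) ∧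
          Tendsto L (𝓝[>] 0) (𝓝 ((-1 / QTomography.sigmaOne ρ T Δ s : ℝ) : EReal))) := by
  have hHp := QTomography.posSemidef_hesse hΔ hs hΔ_smooth
  have hF : Set.InjOn (QTomography.prob ρ T) (QTomography.stateSpace ρ) →
      (QTomography.fisher ρ T s).PosDef := fun hinj =>
    QTomography.posDef_fisher hT hs fun _ hv =>
      QTomography.eq_zero_of_probLinear_eq_zero hinj hs hv
  refine ⟨hHp, fun φ hφ hcons => ?_, fun hIC => ?_⟩
  · have hFp := hF (QTomography.injOn_prob_of_isConsistent hρ hT hΔ hΔ_cont hφ hcons)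
    exact ⟨hFp.det_pos.ne'.isUnit,
      QTomography.maxEigenvalue_sqrt_mul_inv_mul_sqrt_pos hHp hH hFp,
      QTomography.le_liminf_liminf_logErrorRate hρ hT hΔ hΔ_cont hφ hcons hs hΔ_smooth hH hFp⟩
  · have hinj := QTomography.injOn_prob hρ hT hIC
    exact ⟨QTomography.exists_isMLE hρ hT ⟨s, interior_subset hs⟩, fun φ hφ =>
      ⟨hφ.isConsistent hρ hT hinj hΔ hΔ_cont,
        hφ.exists_tendsto_logErrorRate hρ hT hinj hΔ hΔ_cont hs hΔ_smooth hH (hF hinj)⟩⟩
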